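/- Let $G$ be a connected real Lie group whose Lie algebra $\mathfrak g$ is semisimple, and let $H\subset G$ be a maximal torus, that is, a compact connected abelian subgroup not properly contained in another such subgroup. Let $\mathfrak h$ be the Lie algebra of $H$ and $dh$ its normalised Haar measure. Fix an $\mathrm{Ad}_H$-invariant inner product $\langle\cdot,\cdot\rangle$ on $\mathfrak g$, put $\mathfrak m=\mathfrak h^{\perp}$, and let $\mathfrak m=\mathfrak m_0\oplus\mathfrak m_1\oplus\dots\oplus\mathfrak m_r$ be an orthogonal decomposition into $\mathrm{Ad}_H$-invariant subspaces, where $\mathfrak m_0=\{X\in\mathfrak m:\mathrm{Ad}(h)X=X\ \forall h\in H\}$ and $\mathfrak m_j$ is irreducible for $j\ne 0$. Let $A_1,\dots,A_N\in\mathfrak h$ generate $\mathfrak h$ as a Lie algebra, and let $\mathcal L_0=\frac12\sum_{k=1}^N (A_k)^2$ (so that there is no drift, $A_0=0$), where the $A_k$ act as left invariant vector fields on $H$. Let $l\neq 0$. Then there is a number $\lambda_l>0$, uniquely determined by $$\tfrac12\sum_{k=1}^N \mathrm{ad}^2(A_k)\big|_{\mathfrak m_l}=-\lambda_l\,\mathrm{Id}_{\mathfrak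 m_l},$$ such that the following holds for every $Y_0\in\mathfrak m_l$ and every orthonormal basis $Y_1,\dots,Y_d$ of $\mathfrak m_l$. Let $\alpha_j(h)=\langle \mathrm{Ad}(h)Y_0,Y_j\rangle$ for $h\in H$. The Poisson equations $\mathcal L_0\beta_j=\alpha_j$ have smooth solutions on $H$; and for any choice of $C^2$ solutions $\beta_j=\mathcal L_0^{-1}\alpha_j$, the effective operator $$\bar{\mathcal L}f=-\sum_{i,j=1}^d\Big(\int_H \alpha_i\,\mathcal L_0^{-1}\alpha_j\,dh\Big)L_{Y_i^*}L_{Y_j^*}f,\qquad f\in C^2(G;\mathbb R),$$ where $Y^*$ is the left invariant vector field on $G$ generated by $Y\in\mathfrak g$, satisfies $$\bar{\mathcal L}=\frac{|Y_0|^2}{2\lambda_l}\,\Delta_{\mathfrak m_l},\qquad \Delta_{\mathfrak m_l}=\sum_{j=1}^d L_{Z_j^*}L_{Z_j^*}\ \text{ for any orthonormal basis } Z_1,\dots,Z_d \text{ of } \mathfrak m_l .$$ -/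

import Mathlib

open scoped Manifold ContDiff

namespace EffectiveLimit

/-- A smooth real Lie group has the regularity over which Mathlib builds its Lie algebra. -/
instance leInfty_minSmoothness : ENat.LEInfty (minSmoothness ℝ 3) :=
  ⟨by rw [minSmoothness_of_isRCLikeNormedField]; exact ENat.LEInfty.out⟩

noncomputable section

section Group

variable {E : Type*} [NormedAddCommGroup E] [NormedSpace ℝ E]
  {G : Type*} [TopologicalSpace G] [ChartedSpace E G] [Group G]

/-- The adjoint action `Ad g` on the Lie algebra of `G`: the derivative at the identity of the
conjugation `x ↦ g x g⁻¹`. -/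
def adjoint (g : G) : GroupLieAlgebra 𝓘(ℝ, E) G →L[ℝ] GroupLieAlgebra 𝓘(ℝ, E) G :=
  mfderiv 𝓘(ℝ, E) 𝓘(ℝ, E) (fun x : G => g * x * g⁻¹) 1

/-- `L_X f`: the derivative of `f` along the left invariant vector field generated by `X`. -/
def leftDeriv (X : GroupLieAlgebra 𝓘(ℝ, E) G) (f : G → ℝ) : G → ℝ :=
  fun g => mfderiv 𝓘(ℝ, E) 𝓘(ℝ, ℝ) f g (mulInvariantVectorField X g)

/-- The Hörmander type operator `½ ∑ₖ (Aₖ)² + A₀` of left invariant vector fields. -/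
def hormanderOp {N : ℕ} (A₀ : GroupLieAlgebra 𝓘(ℝ, E) G)
    (A : Fin N → GroupLieAlgebra 𝓘(ℝ, E) G) (u : G → ℝ) : G → ℝ :=
  fun g => 1 / 2 * ∑ k, leftDeriv (A k) (leftDeriv (A k) u) g + leftDeriv A₀ u g

/-- The operator `∑ⱼ L_{Yⱼ} L_{Yⱼ}` (for `Y` an orthonormal basis of a subspace `V` of the Lie
algebra this is `Δ_V`). -/
def sumSquares {d : ℕ} (Y : Fin d → GroupLieAlgebra 𝓘(ℝ, E) G) (f : G → ℝ) : G → ℝ :=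
  fun g => ∑ j, leftDeriv (Y j) (leftDeriv (Y j) f) g

/-- `Y` is an orthonormal basis of the subspace `V` for the inner product `B`. -/
structure IsOrthonormalBasisOf (B : LinearMap.BilinForm ℝ (GroupLieAlgebra 𝓘(ℝ, E) G))
    (V : Submodule ℝ (GroupLieAlgebra 𝓘(ℝ, E) G)) {d : ℕ}
    (Y : Fin d → GroupLieAlgebra 𝓘(ℝ, E) G) : Prop where
  orthonormal : ∀ i j, B (Y i) (Y j) = if i = j then 1 else 0
  span_eq : Submodule.span ℝ (Set.range Y) = V

/-- `B` is an `Ad_H`-invariant inner product on the Lie algebra of `G`. -/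
structure IsAdInvariantInner (H : Subgroup G)
    (B : LinearMap.BilinForm ℝ (GroupLieAlgebra 𝓘(ℝ, E) G)) : Prop where
  symm : ∀ X Y, B X Y = B Y X
  pos : ∀ X, X ≠ 0 → 0 < B X X
  invariant : ∀ h ∈ H, ∀ X Y, B (adjoint h X) (adjoint h Y) = B X Y

/-- `V` is stable under `Ad h` for all `h ∈ H`. -/
def IsAdInvariant (H : Subgroup G) (V : Submodule ℝ (GroupLieAlgebra 𝓘(ℝ, E) G)) : Prop :=
  ∀ h ∈ H, ∀ X ∈ V, adjoint h X ∈ V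

/-- `V` is a (nonzero) irreducible `Ad_H`-invariant subspace. -/
structure IsAdIrreducible (H : Subgroup G)
    (V : Submodule ℝ (GroupLieAlgebra 𝓘(ℝ, E) G)) : Prop where
  ne_bot : V ≠ ⊥
  invariant : IsAdInvariant H V
  eq_bot_or_eq : ∀ W ≤ V, IsAdInvariant H W → W = ⊥ ∨ W = V

/-- `K` is a torus in `G`: a compact connected abelian subgroup. -/
structure IsTorus (K : Subgroup G) : Prop where
  compact : IsCompact (K : Set G)
  connected : IsConnected (K : Set G)
  comm : ∀ x ∈ K, ∀ y ∈ K, x * y = y * x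

/-- `K` is a maximal torus of `G`: a torus not properly contained in another torus. -/
structure IsMaximalTorus (K : Subgroup G) : Prop extends IsTorus K where
  maximal : ∀ K' : Subgroup G, IsTorus K' → K ≤ K' → K' ≤ K

end Group

section Subgroup

variable {E : Type*} [NormedAddCommGroup E] [NormedSpace ℝ E]
  {G : Type*} [TopologicalSpace G] [ChartedSpace E G] [Group G]
  {F : Type*} [NormedAddCommGroup F] [NormedSpace ℝ F]
  (H : Subgroup G) [ChartedSpace F H]

/-- The given smooth structure on the subgroup `H`, whose topology is the subspace topology, makes
`H` an embedded submanifold of `G`: the inclusion is a smooth immersion. -/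
structure IsEmbeddedSubgroup : Prop where
  smooth : ContMDiff 𝓘(ℝ, F) 𝓘(ℝ, E) ∞ (Subtype.val : H → G)
  immersion : ∀ h : H,
    Function.Injective (mfderiv 𝓘(ℝ, F) 𝓘(ℝ, E) (Subtype.val : H → G) h)

/-- The inclusion of the Lie algebra of `H` in the Lie algebra of `G`: the derivative at the
identity of the inclusion of groups. -/
def lieIncl : GroupLieAlgebra 𝓘(ℝ, F) H →L[ℝ] GroupLieAlgebra 𝓘(ℝ, E) G :=
  mfderiv 𝓘(ℝ, F) 𝓘(ℝ, E) (Subtype.val : H → G) 1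

/-- The Lie algebra `𝔥` of `H` as a subspace of the Lie algebra of `G`. -/
def lieSubspace : Submodule ℝ (GroupLieAlgebra 𝓘(ℝ, E) G) :=
  LinearMap.range (lieIncl H : GroupLieAlgebra 𝓘(ℝ, F) H →L[ℝ] GroupLieAlgebra 𝓘(ℝ, E) G).toLinearMap

/-- `𝔪 = 𝔪₀ ⊕ 𝔪₁ ⊕ ⋯ ⊕ 𝔪ᵣ` is an orthogonal decomposition of `𝔪 = 𝔥^⊥`, where `𝔪₀` consists of
the vectors of `𝔪` fixed by `Ad_H`, and the other summands are `Ad_H`-invariant and irreducible. -/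
structure IsAdDecomposition (B : LinearMap.BilinForm ℝ (GroupLieAlgebra 𝓘(ℝ, E) G)) {r : ℕ}
    (𝔪 : Fin (r + 1) → Submodule ℝ (GroupLieAlgebra 𝓘(ℝ, E) G)) : Prop where
  orthogonal : ∀ i j, i ≠ j → ∀ X ∈ 𝔪 i, ∀ Y ∈ 𝔪 j, B X Y = 0
  iSup_eq : ⨆ i, 𝔪 i = B.orthogonal (lieSubspace (F := F) H)
  mem_zero : ∀ X, X ∈ 𝔪 0 ↔
    X ∈ B.orthogonal (lieSubspace (F := F) H) ∧ ∀ h ∈ H, adjoint h X = X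
  irreducible : ∀ j, j ≠ 0 → IsAdIrreducible H (𝔪 j)

/-- `A₁, …, A_N`, elements of the Lie algebra of `H`, generate it as a Lie algebra. -/
def IsLieGenerating [CompleteSpace E] [LieGroup 𝓘(ℝ, E) ∞ G] {N : ℕ}
    (A : Fin N → GroupLieAlgebra 𝓘(ℝ, F) H) : Prop :=
  (LieSubalgebra.lieSpan ℝ (GroupLieAlgebra 𝓘(ℝ, E) G)
    (Set.range fun k => (lieIncl H (A k) : GroupLieAlgebra 𝓘(ℝ, E) G))).toSubmodule
      = lieSubspace (F := F) H

variable {H}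

/-- The function `α(Y₀, Y)(h) = ⟨Ad(h) Y₀, Y⟩` on `H`. -/
def adCoeff (B : LinearMap.BilinForm ℝ (GroupLieAlgebra 𝓘(ℝ, E) G))
    (Y₀ Y : GroupLieAlgebra 𝓘(ℝ, E) G) : H → ℝ :=
  fun h => B (adjoint (h : G) Y₀) Y

/-- `β` is a (`C²`) solution on `H` of the Poisson equation `𝓛₀ β = α`, where
`𝓛₀ = ½ ∑ₖ (Aₖ)² + A₀`; that is, `β` is a value of `𝓛₀⁻¹ α`. -/
structure IsPoissonSolution {N : ℕ} (A₀ : GroupLieAlgebra 𝓘(ℝ, F) H)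
    (A : Fin N → GroupLieAlgebra 𝓘(ℝ, F) H) (α β : H → ℝ) : Prop where
  contMDiff : ContMDiff 𝓘(ℝ, F) 𝓘(ℝ, ℝ) 2 β
  eq : ∀ h, hormanderOp A₀ A β h = α h

/-- The effective operator
`𝓛̄ f = - ∑ᵢⱼ (∫_H α(Y₀, Yᵢ) 𝓛₀⁻¹ α(Y₀, Yⱼ) dh) L_{Yᵢ} L_{Yⱼ} f`, where `β j` stands for
`𝓛₀⁻¹ α(Y₀, Yⱼ)`. -/
def effectiveOp [MeasurableSpace G] (μ : MeasureTheory.Measure H)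
    (B : LinearMap.BilinForm ℝ (GroupLieAlgebra 𝓘(ℝ, E) G)) {d : ℕ}
    (Y₀ : GroupLieAlgebra 𝓘(ℝ, E) G) (Y : Fin d → GroupLieAlgebra 𝓘(ℝ, E) G)
    (β : Fin d → H → ℝ) (f : G → ℝ) : G → ℝ :=
  fun g => -∑ i, ∑ j, (∫ h : H, adCoeff B Y₀ (Y i) h * β j h ∂μ) *
    leftDeriv (Y i) (leftDeriv (Y j) f) g

end Subgroup

end

end EffectiveLimit

open EffectiveLimit

/-!
For `X` in the Lie algebra of `G`, the derivative of `h ↦ Ad(h) X` along `A ∈ 𝔥` is `Ad(h) [A, X]`,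
so `𝓛₀` acts on matrix coefficients of `Ad` through `½ ∑ₖ ad²(Aₖ)`. Each `ad A` is skew for the
invariant inner product and, `H` being abelian, commutes with `Ad_H`; by Schur's lemma the sum of
their squares is a scalar `-2λ` on `𝔪ₗ`, and `λ ≠ 0` since the vectors killed by all `ad Aₖ` lie in
`𝔪₀`. The `αⱼ` are thus eigenfunctions, and as `𝓛₀` is symmetric, every solution `βⱼ` pairs with
them as `-λ⁻¹ αⱼ` does. Schur orthogonality evaluates `∫ αᵢ αⱼ dh` as `|Y₀|² / dim 𝔪ₗ` times `δᵢⱼ`.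
Finally `dim 𝔪ₗ = 2`: a nonzero `ad Aₖ` is a multiple of a complex structure on `𝔪ₗ`, for which
`Ad_H` acts by complex scalars.
-/

namespace EffectiveLimit

noncomputable section

open Filter Topology

section Representation

open scoped InnerProductSpace
open MeasureTheory InnerProductSpace

section Irreducible

variable {Γ k V : Type*} [Monoid Γ] [Field k] [AddCommGroup V] [Module k V]
  (ρ : Representation k Γ V) [ρ.IsIrreducible]

include ρ in
theorem nontrivial_of_isIrreducible : Nontrivial V :=
  IsSimpleModule.nontrivial (MonoidAlgebra k Γ) ρ.asModule

theorem eq_bot_or_eq_top_of_forall_mem (W : Submodule k V) (hW : ∀ g, ∀ x ∈ W, ρ g x ∈ W) :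
    W = ⊥ ∨ W = ⊤ :=
  let W' : Subrepresentation ρ := ⟨W, fun g x hx => hW g x hx⟩
  (eq_bot_or_eq_top W').imp (congrArg Subrepresentation.toSubmodule)
    (congrArg Subrepresentation.toSubmodule)

end Irreducible

variable {Γ V : Type*} [NormedAddCommGroup V] [InnerProductSpace ℝ V]

section Symmetric

variable [Monoid Γ] (ρ : Representation ℝ Γ V) [ρ.IsIrreducible] [FiniteDimensional ℝ V]

theorem exists_eq_smul_one_of_commute_isSymmetric {T : Module.End ℝ V} (hT : T.IsSymmetric)
    (hρT : ∀ g, Commute (ρ g) T) : ∃ c : ℝ, T = c • 1 := by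
  have := nontrivial_of_isIrreducible ρ
  obtain ⟨c, hc⟩ : ∃ c : ℝ, T.HasEigenvalue c := ⟨_, hT.hasEigenvalue_iSup_of_finiteDimensional⟩
  have hinv : ∀ g, ∀ x ∈ T.eigenspace c, ρ g x ∈ T.eigenspace c := fun g x hx => by
    rw [Module.End.mem_eigenspace_iff] at hx ⊢
    rw [← Module.End.mul_apply, ← (hρT g).eq, Module.End.mul_apply, hx, map_smul]
  have htop := (eq_bot_or_eq_top_of_forall_mem ρ _ hinv).resolve_left hc
  refine ⟨c, LinearMap.ext fun x => ?_⟩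
  have hx : x ∈ T.eigenspace c := htop ▸ Submodule.mem_top
  simpa using Module.End.mem_eigenspace_iff.mp hx

theorem exists_sum_sq_eq_neg_smul_of_commute_skew {ι : Type*} [Fintype ι] {J : ι → Module.End ℝ V}
    (hJ : ∀ k x y, ⟪J k x, y⟫_ℝ = -⟪x, J k y⟫_ℝ) (hρJ : ∀ k g, Commute (ρ g) (J k))
    (hne : ∃ k, J k ≠ 0) : ∃ c : ℝ, 0 < c ∧ ∀ x, ∑ k, J k (J k x) = -(c • x) := by
  obtain ⟨k₀, hk₀⟩ := hne
  obtain ⟨x, hx⟩ : ∃ x, J k₀ x ≠ 0 := by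
    by_contra! h
    exact hk₀ (LinearMap.ext h)
  obtain ⟨a, ha⟩ := exists_eq_smul_one_of_commute_isSymmetric ρ (T := ∑ k, J k * J k)
    (fun y z => by simp [LinearMap.sum_apply, sum_inner, inner_sum, hJ])
    (fun g => Commute.sum_right _ _ _ fun k _ => (hρJ k g).mul_right (hρJ k g))
  have hnorm : a * ‖x‖ ^ 2 = -∑ k, ‖J k x‖ ^ 2 := by
    have := congrArg (fun T : Module.End ℝ V => ⟪T x, x⟫_ℝ) ha
    simpa [LinearMap.sum_apply, sum_inner, hJ, real_inner_smul_left] using this.symm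
  have hpos : 0 < ∑ k, ‖J k x‖ ^ 2 :=
    Finset.sum_pos' (fun _ _ => sq_nonneg _) ⟨k₀, Finset.mem_univ _, pow_pos (norm_pos_iff.2 hx) 2⟩
  refine ⟨-a, ?_, fun y => by simpa [LinearMap.sum_apply] using LinearMap.congr_fun ha y⟩
  by_contra! h
  nlinarith [sq_nonneg ‖x‖]

end Symmetric

section Orthogonal

theorem inner_apply_left_eq_inner_inv_apply [Group Γ] {ρ : Representation ℝ Γ V}
    (hρ : ∀ g x y, ⟪ρ g x, ρ g y⟫_ℝ = ⟪x, y⟫_ℝ) (g : Γ) (x y : V) :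
    ⟪ρ g x, y⟫_ℝ = ⟪x, ρ g⁻¹ y⟫_ℝ := by
  rw [← hρ g x, ρ.self_inv_apply]

variable [FiniteDimensional ℝ V]

-- Both `ρ g + ρ g⁻¹` and `J (ρ g - ρ g⁻¹)` are symmetric, hence scalar.
theorem exists_eq_smul_one_add_smul_of_commute_skew [Group Γ] [IsMulCommutative Γ]
    {ρ : Representation ℝ Γ V} [ρ.IsIrreducible] (hρ : ∀ g x y, ⟪ρ g x, ρ g y⟫_ℝ = ⟪x, y⟫_ℝ)
    {J : Module.End ℝ V} (hJ : ∀ x y, ⟪J x, y⟫_ℝ = -⟪x, J y⟫_ℝ) (hρJ : ∀ g, Commute (ρ g) J)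
    {c : ℝ} (hc : c ≠ 0) (hJJ : J * J = -(c • 1)) (g : Γ) : ∃ a b : ℝ, ρ g = a • 1 + b • J := by
  have hcomm : ∀ h k, Commute (ρ h) (ρ k) := fun h k => Commute.map (mul_comm' h k) ρ
  have hadj := inner_apply_left_eq_inner_inv_apply hρ
  obtain ⟨a, ha⟩ := exists_eq_smul_one_of_commute_isSymmetric ρ (T := ρ g + ρ g⁻¹)
    (fun x y => by simp [inner_add_left, inner_add_right, hadj, add_comm])
    fun h => (hcomm h g).add_right (hcomm h g⁻¹)
  obtain ⟨b, hb⟩ := exists_eq_smul_one_of_commute_isSymmetric ρ (T := J * (ρ g - ρ g⁻¹))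
    (fun x y => by
      have hJρ : ∀ k, ρ k (J y) = J (ρ k y) := fun k => LinearMap.congr_fun (hρJ k).eq y
      simp [inner_sub_left, inner_sub_right, hJ, hadj, hJρ]
      abel)
    fun h => (hρJ h).mul_right ((hcomm h g).sub_right (hcomm h g⁻¹))
  have hdiff : ρ g - ρ g⁻¹ = -(c⁻¹ * b) • J := by
    have := congrArg (J * ·) hb
    simp only [← mul_assoc, hJJ, mul_smul_comm, mul_one, neg_mul, smul_mul_assoc, one_mul] at this
    rw [neg_smul, mul_smul, ← this, smul_neg, neg_neg, inv_smul_smul₀ hc]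
  refine ⟨a / 2, -(c⁻¹ * b) / 2, ?_⟩
  rw [div_eq_inv_mul, div_eq_inv_mul, mul_smul, mul_smul, ← ha, ← hdiff]
  module

theorem finrank_eq_two_of_commute_skew [Group Γ] [IsMulCommutative Γ] {ρ : Representation ℝ Γ V}
    [ρ.IsIrreducible] (hρ : ∀ g x y, ⟪ρ g x, ρ g y⟫_ℝ = ⟪x, y⟫_ℝ) {J : Module.End ℝ V}
    (hJ : ∀ x y, ⟪J x, y⟫_ℝ = -⟪x, J y⟫_ℝ) (hρJ : ∀ g, Commute (ρ g) J) (hne : J ≠ 0) :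
    Module.finrank ℝ V = 2 := by
  obtain ⟨c, hc, hJJ⟩ : ∃ c : ℝ, 0 < c ∧ ∀ x, J (J x) = -(c • x) := by
    simpa using exists_sum_sq_eq_neg_smul_of_commute_skew ρ (J := fun _ : Unit => J) (fun _ => hJ)
      (fun _ => hρJ) ⟨(), hne⟩
  choose a b hab using exists_eq_smul_one_add_smul_of_commute_skew hρ hJ hρJ hc.ne'
    (LinearMap.ext hJJ)
  have := nontrivial_of_isIrreducible ρ
  obtain ⟨x, hx⟩ := exists_ne (0 : V)
  have hJx : J x ≠ 0 := fun h => by simpa [h, hc.ne', hx] using hJJ x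
  have hspan : Submodule.span ℝ {x, J x} = ⊤ := by
    refine (eq_bot_or_eq_top_of_forall_mem ρ _ fun g y hy => ?_).resolve_left fun h => hx ?_
    · rw [Submodule.mem_span_pair] at hy ⊢
      obtain ⟨s, t, rfl⟩ := hy
      refine ⟨a g * s - b g * (t * c), a g * t + b g * s, ?_⟩
      simp only [hab, LinearMap.add_apply, LinearMap.smul_apply, Module.End.one_apply, map_add,
        map_smul, hJJ]
      module
    · simpa [h] using Submodule.subset_span (R := ℝ) (Set.mem_insert x {J x})
  have hxJx : ⟪x, J x⟫_ℝ = 0 := by linarith [hJ x x, real_inner_comm x (J x)]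
  have hli : LinearIndependent ℝ ![x, J x] :=
    linearIndependent_of_ne_zero_of_inner_eq_zero (𝕜 := ℝ) (by simp [Fin.forall_fin_two, hx, hJx])
      (by simp [Pairwise, Fin.forall_fin_two, hxJx, real_inner_comm])
  calc Module.finrank ℝ V = Module.finrank ℝ (Submodule.span ℝ (Set.range ![x, J x])) := by
        rw [Matrix.range_cons_cons_empty, hspan, finrank_top]
    _ = 2 := finrank_span_eq_card hli

end Orthogonal

section SchurOrthogonality

variable [Group Γ] [MeasurableSpace Γ] {μ : Measure Γ} {ρ : Representation ℝ Γ V} {x : V}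

/-- The operator `y ↦ ∫ g, ⟪ρ g x, y⟫ ρ g x` of a representation `ρ`: its matrix coefficients are
the correlations under `μ` of those of `ρ` at `x`. -/
def correlation (μ : Measure Γ) (ρ : Representation ℝ Γ V) (x : V) : V →L[ℝ] V :=
  ∫ g, rankOne ℝ (ρ g x) (ρ g x) ∂μ

theorem integrable_rankOne [IsFiniteMeasure μ] (hρ : ∀ g x y, ⟪ρ g x, ρ g y⟫_ℝ = ⟪x, y⟫_ℝ)
    (hx : AEStronglyMeasurable (fun g => ρ g x) μ) :
    Integrable (fun g => rankOne ℝ (ρ g x) (ρ g x)) μ := by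
  have hnorm : ∀ g, ‖ρ g x‖ = ‖x‖ := fun g => by
    rw [norm_eq_sqrt_real_inner, hρ, norm_eq_sqrt_real_inner]
  refine .of_bound (C := ‖x‖ * ‖x‖) ?_ (.of_forall fun g => by simp [norm_rankOne, hnorm])
  have : Continuous fun v : V => rankOne ℝ v v :=
    (rankOne ℝ (E := V) (F := V)).continuous.clm_apply continuous_id
  exact this.comp_aestronglyMeasurable hx

variable [FiniteDimensional ℝ V]

theorem inner_correlation_apply [IsFiniteMeasure μ] (hρ : ∀ g x y, ⟪ρ g x, ρ g y⟫_ℝ = ⟪x, y⟫_ℝ)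
    (hx : AEStronglyMeasurable (fun g => ρ g x) μ) (y z : V) :
    ⟪correlation μ ρ x y, z⟫_ℝ = ∫ g, ⟪ρ g x, y⟫_ℝ * ⟪ρ g x, z⟫_ℝ ∂μ := by
  have hint := integrable_rankOne hρ hx
  rw [correlation, ContinuousLinearMap.integral_apply hint, real_inner_comm,
    ← integral_inner (hint.apply_continuousLinearMap y)]
  simp [real_inner_smul_right, real_inner_comm]

theorem commute_correlation [MeasurableMul Γ] [IsFiniteMeasure μ] [μ.IsMulLeftInvariant]
    (hρ : ∀ g x y, ⟪ρ g x, ρ g y⟫_ℝ = ⟪x, y⟫_ℝ)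
    (hx : AEStronglyMeasurable (fun g => ρ g x) μ) (g : Γ) :
    Commute (ρ g) (correlation μ ρ x).toLinearMap := by
  refine LinearMap.ext fun y => ext_inner_right ℝ fun z => ?_
  calc ⟪ρ g (correlation μ ρ x y), z⟫_ℝ
      = ∫ h, ⟪ρ h x, y⟫_ℝ * ⟪ρ h x, ρ g⁻¹ z⟫_ℝ ∂μ := by
        rw [inner_apply_left_eq_inner_inv_apply hρ, inner_correlation_apply hρ hx]
    _ = ∫ h, ⟪ρ (g * h) x, ρ g y⟫_ℝ * ⟪ρ (g * h) x, z⟫_ℝ ∂μ := by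
        simp only [map_mul, Module.End.mul_apply, hρ, inner_apply_left_eq_inner_inv_apply hρ g _ z]
    _ = ⟪correlation μ ρ x (ρ g y), z⟫_ℝ := by
        rw [inner_correlation_apply hρ hx,
          integral_mul_left_eq_self fun h => ⟪ρ h x, ρ g y⟫_ℝ * ⟪ρ h x, z⟫_ℝ]

theorem trace_correlation [IsProbabilityMeasure μ] (hρ : ∀ g x y, ⟪ρ g x, ρ g y⟫_ℝ = ⟪x, y⟫_ℝ)
    (hx : AEStronglyMeasurable (fun g => ρ g x) μ) :
    LinearMap.trace ℝ V (correlation μ ρ x).toLinearMap = ‖x‖ ^ 2 := by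
  let tr : (V →L[ℝ] V) →L[ℝ] ℝ :=
    (LinearMap.trace ℝ V ∘ₗ ContinuousLinearMap.coeLM ℝ).toContinuousLinearMap
  have htr : ∀ v, tr (rankOne ℝ v v) = ⟪v, v⟫_ℝ := fun v => trace_rankOne v v
  calc LinearMap.trace ℝ V (correlation μ ρ x).toLinearMap
      = tr (correlation μ ρ x) := rfl
    _ = ∫ g, tr (rankOne ℝ (ρ g x) (ρ g x)) ∂μ :=
        (tr.integral_comp_comm (integrable_rankOne hρ hx)).symm
    _ = ∫ _, ⟪x, x⟫_ℝ ∂μ := by simp only [htr, hρ]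
    _ = ‖x‖ ^ 2 := by simp

theorem integral_inner_mul_inner [MeasurableMul Γ] [IsProbabilityMeasure μ] [μ.IsMulLeftInvariant]
    [ρ.IsIrreducible] (hρ : ∀ g x y, ⟪ρ g x, ρ g y⟫_ℝ = ⟪x, y⟫_ℝ)
    (hx : AEStronglyMeasurable (fun g => ρ g x) μ) (y z : V) :
    ∫ g, ⟪ρ g x, y⟫_ℝ * ⟪ρ g x, z⟫_ℝ ∂μ = ‖x‖ ^ 2 / Module.finrank ℝ V * ⟪y, z⟫_ℝ := by
  have := nontrivial_of_isIrreducible ρ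
  obtain ⟨c, hc⟩ := exists_eq_smul_one_of_commute_isSymmetric ρ
    (T := (correlation μ ρ x).toLinearMap)
    (fun y z => by
      rw [ContinuousLinearMap.coe_coe, real_inner_comm _ y]
      simp only [inner_correlation_apply hρ hx, mul_comm]) (commute_correlation hρ hx)
  have htrace : c * Module.finrank ℝ V = ‖x‖ ^ 2 := by
    rw [← trace_correlation hρ hx, hc, map_smul, LinearMap.trace_one, smul_eq_mul]
  rw [← inner_correlation_apply hρ hx, ← htrace,
    mul_div_cancel_right₀ _ (by simp [Module.finrank_pos.ne']), ← real_inner_smul_left]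
  exact congrArg (⟪·, z⟫_ℝ) (LinearMap.congr_fun hc y)

end SchurOrthogonality

end Representation

section AdjointRepresentation

variable {E : Type*} [NormedAddCommGroup E] [NormedSpace ℝ E]

theorem inTangentCoordinates_of_forall_eq {N M : Type*} [TopologicalSpace M] [ChartedSpace E M]
    [IsManifold 𝓘(ℝ, E) 1 M] {f g : N → M} {p : M} (hf : ∀ x, f x = p) (hg : ∀ x, g x = p)
    (ϕ : N → E →L[ℝ] E) (x₀ x : N) :
    inTangentCoordinates 𝓘(ℝ, E) 𝓘(ℝ, E) f g ϕ x₀ x = ϕ x := by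
  have hp : p ∈ (chartAt E p).source := mem_chart_source E p
  obtain rfl : f = fun _ => p := funext hf
  obtain rfl : g = fun _ => p := funext hg
  rw [inTangentCoordinates_eq _ _ _ hp hp]
  ext v
  simp only [ContinuousLinearMap.comp_apply]
  rw [(tangentBundleCore 𝓘(ℝ, E) M).coordChange_self _ _ hp,
    (tangentBundleCore 𝓘(ℝ, E) M).coordChange_self _ _ hp]

variable {G : Type*} [TopologicalSpace G] [ChartedSpace E G] [Group G]

theorem adjoint_one : adjoint (E := E) (1 : G) = 1 := by
  have h : (fun x : G => 1 * x * 1⁻¹) = id := by ext; simp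
  rw [adjoint, h]
  exact mfderiv_id

/-- The Lie algebra of `G`, which carries no norm, identified with the model space of `G`: the
two types are equal, and the chart at the identity has derivative the identity there. -/
def lieModel : GroupLieAlgebra 𝓘(ℝ, E) G ≃L[ℝ] E :=
  ContinuousLinearEquiv.refl ℝ E

variable [LieGroup 𝓘(ℝ, E) ∞ G]

theorem mdifferentiable_mul_left (g : G) :
    MDifferentiable 𝓘(ℝ, E) 𝓘(ℝ, E) (fun x : G => g * x) :=
  (contMDiff_mul_left (n := ∞)).mdifferentiable (by simp)

theorem mdifferentiable_mul_right (g : G) :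
    MDifferentiable 𝓘(ℝ, E) 𝓘(ℝ, E) (fun x : G => x * g) :=
  (contMDiff_mul_right (n := ∞)).mdifferentiable (by simp)

theorem mdifferentiable_conj (g : G) :
    MDifferentiable 𝓘(ℝ, E) 𝓘(ℝ, E) (fun x : G => g * x * g⁻¹) :=
  (mdifferentiable_mul_right g⁻¹).comp (mdifferentiable_mul_left g)

theorem adjoint_mul_apply (g h : G) (X : GroupLieAlgebra 𝓘(ℝ, E) G) :
    adjoint (g * h) X = adjoint g (adjoint h X) := by
  have hcomp : (fun x : G => g * h * x * (g * h)⁻¹)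
      = (fun x => g * x * g⁻¹) ∘ (fun x => h * x * h⁻¹) := by ext; simp [mul_assoc]
  rw [adjoint, hcomp]
  exact mfderiv_comp_apply_of_eq 1 (mdifferentiable_conj g 1) (mdifferentiable_conj h 1)
    (by simp) X

theorem contMDiff_adjoint_apply (X : GroupLieAlgebra 𝓘(ℝ, E) G) :
    ContMDiff 𝓘(ℝ, E) 𝓘(ℝ, E) ∞ (fun g : G => lieModel (adjoint g X)) := by
  have : IsManifold 𝓘(ℝ, E) ∞ G := inferInstance
  intro g
  have hconj : ContMDiff (𝓘(ℝ, E).prod 𝓘(ℝ, E)) 𝓘(ℝ, E) ∞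
      (fun p : G × G => p.1 * p.2 * p.1⁻¹) :=
    (contMDiff_fst.mul contMDiff_snd).mul contMDiff_fst.inv
  have hderiv := (ContMDiffAt.mfderiv (m := ∞) (fun x y : G => x * y * x⁻¹) (fun _ => 1)
    (hconj (g, 1)) contMDiffAt_const (by simp)).clm_apply
      (contMDiffAt_const (c := lieModel (G := G) X))
  refine hderiv.congr_of_eventuallyEq (.of_forall fun x => ?_)
  exact congrArg (fun T : E →L[ℝ] E => T (lieModel X))
    (inTangentCoordinates_of_forall_eq (E := E) (p := (1 : G)) (fun _ => rfl) (by simp) _ g x).symm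

/-- `g x = (g x g⁻¹) g`: left translation by `g` is conjugation followed by right translation. -/
theorem mvfderiv_comp_mul_left_one {V : Type*} [NormedAddCommGroup V] [NormedSpace ℝ V]
    {f : G → V} {g : G} (hf : MDifferentiableAt 𝓘(ℝ, E) 𝓘(ℝ, V) f g)
    (X : GroupLieAlgebra 𝓘(ℝ, E) G) :
    mvfderiv 𝓘(ℝ, E) (fun x => f (g * x)) 1 X
      = mvfderiv 𝓘(ℝ, E) (fun x => f (x * g)) 1 (adjoint g X) := by
  have hcomp : (fun x => f (g * x)) = (fun x => f (x * g)) ∘ (fun x => g * x * g⁻¹) := by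
    ext; simp
  have hright : MDifferentiableAt 𝓘(ℝ, E) 𝓘(ℝ, V) (fun x => f (x * g)) 1 :=
    MDifferentiableAt.comp (I' := 𝓘(ℝ, E)) 1 (by rwa [one_mul]) (mdifferentiable_mul_right g 1)
  rw [hcomp]
  exact mfderiv_comp_apply_of_eq 1 hright (mdifferentiable_conj g 1) (by simp) X

theorem mvfderiv_comp_mul_left {V : Type*} [NormedAddCommGroup V] [NormedSpace ℝ V]
    {f : G → V} {g : G} (hf : MDifferentiableAt 𝓘(ℝ, E) 𝓘(ℝ, V) f g)
    (X : GroupLieAlgebra 𝓘(ℝ, E) G) :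
    mvfderiv 𝓘(ℝ, E) (fun x => f (g * x)) 1 X
      = mvfderiv 𝓘(ℝ, E) f g (mulInvariantVectorField X g) :=
  mfderiv_comp_apply_of_eq (f := fun x => g * x) 1 hf (mdifferentiable_mul_left g 1) (mul_one g) X

end AdjointRepresentation

section ChartAtOne

variable {E : Type*} [NormedAddCommGroup E] [NormedSpace ℝ E]
  {G : Type*} [TopologicalSpace G] [ChartedSpace E G] [Group G]

variable (E G) in
/-- The preferred chart of `G` at the identity. -/
abbrev oneChart : PartialEquiv G E := extChartAt 𝓘(ℝ, E) (1 : G)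

variable (E G) in
/-- The multiplication of `G`, read in the preferred chart at the identity. -/
def chartMul (p : E × E) : E := oneChart E G ((oneChart E G).symm p.1 * (oneChart E G).symm p.2)

variable (E G) in
/-- The coordinate of the identity in its preferred chart. -/
def chartOne : E := oneChart E G 1

theorem symm_chartOne : (oneChart E G).symm (chartOne E G) = 1 := extChartAt_to_inv 1

theorem target_mem_nhds_chartOne : (oneChart E G).target ∈ 𝓝 (chartOne E G) :=
  extChartAt_target_mem_nhds (I := 𝓘(ℝ, E)) (1 : G)

theorem symm_mem_source {x : E} (hx : x ∈ (oneChart E G).target) :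
    (oneChart E G).symm x ∈ (chartAt E (1 : G)).source := by
  simpa only [extChartAt_source] using (oneChart E G).map_target hx

theorem hasFDerivAt_comp_symm_chartOne {V : Type*} [NormedAddCommGroup V] [NormedSpace ℝ V]
    {f : G → V} (hf : MDifferentiableAt 𝓘(ℝ, E) 𝓘(ℝ, V) f 1) :
    HasFDerivAt (f ∘ (oneChart E G).symm) (mvfderiv 𝓘(ℝ, E) f 1 : E →L[ℝ] V) (chartOne E G) := by
  have h := hf.hasMFDerivAt.2
  rw [modelWithCornersSelf_coe, Set.range_id] at h
  exact h.hasFDerivAt_of_univ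

theorem mvfderiv_eq_zero_of_forall_le_one {f : G → ℝ}
    (hf : MDifferentiableAt 𝓘(ℝ, E) 𝓘(ℝ, ℝ) f 1) (hmax : ∀ g, f g ≤ f 1) :
    mvfderiv 𝓘(ℝ, E) f 1 = 0 := by
  have hchart : IsLocalMax (f ∘ (oneChart E G).symm) (chartOne E G) := .of_forall fun y => by
    simpa only [Function.comp_apply, symm_chartOne] using hmax _
  exact hchart.hasFDerivAt_eq_zero (hasFDerivAt_comp_symm_chartOne hf)

variable [LieGroup 𝓘(ℝ, E) ∞ G]

theorem contDiffAt_chartMul : ContDiffAt ℝ ∞ (chartMul E G) (chartOne E G, chartOne E G) := by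
  have : IsManifold 𝓘(ℝ, E) ∞ G := inferInstance
  have hsymm : ContMDiffAt 𝓘(ℝ, E) 𝓘(ℝ, E) ∞ (oneChart E G).symm (chartOne E G) :=
    (contMDiffOn_extChartAt_symm 1).contMDiffAt target_mem_nhds_chartOne
  have hfst : ContMDiffAt 𝓘(ℝ, E × E) 𝓘(ℝ, E) ∞ (fun p : E × E => (oneChart E G).symm p.1)
      (chartOne E G, chartOne E G) :=
    hsymm.comp_of_eq contDiff_fst.contMDiff.contMDiffAt rfl
  have hsnd : ContMDiffAt 𝓘(ℝ, E × E) 𝓘(ℝ, E) ∞ (fun p : E × E => (oneChart E G).symm p.2)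
      (chartOne E G, chartOne E G) :=
    hsymm.comp_of_eq contDiff_snd.contMDiff.contMDiffAt rfl
  refine contMDiffAt_iff_contDiffAt.mp (ContMDiffAt.comp (I' := 𝓘(ℝ, E)) _ ?_ (hfst.mul hsnd))
  apply contMDiffAt_extChartAt'
  simp only [symm_chartOne, mul_one, mem_chart_source]

theorem mdifferentiableAt_chart_mul_left {g : G} (hg : g ∈ (chartAt E (1 : G)).source) :
    MDifferentiableAt 𝓘(ℝ, E) 𝓘(ℝ, E) (fun y : G => oneChart E G (g * y)) 1 :=
  have : IsManifold 𝓘(ℝ, E) 1 G := inferInstance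
  MDifferentiableAt.comp (I' := 𝓘(ℝ, E)) 1 (mdifferentiableAt_extChartAt (by rwa [mul_one]))
    (mdifferentiable_mul_left g 1)

theorem mdifferentiableAt_chart_mul_right {g : G} (hg : g ∈ (chartAt E (1 : G)).source) :
    MDifferentiableAt 𝓘(ℝ, E) 𝓘(ℝ, E) (fun y : G => oneChart E G (y * g)) 1 :=
  have : IsManifold 𝓘(ℝ, E) 1 G := inferInstance
  MDifferentiableAt.comp (I' := 𝓘(ℝ, E)) 1 (mdifferentiableAt_extChartAt (by rwa [one_mul]))
    (mdifferentiable_mul_right g 1)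

theorem fderiv_chartMul_inr {x : E} (hx : x ∈ (oneChart E G).target)
    (hm : DifferentiableAt ℝ (chartMul E G) (x, chartOne E G))
    (X : GroupLieAlgebra 𝓘(ℝ, E) G) :
    fderiv ℝ (chartMul E G) (x, chartOne E G) (0, lieModel X)
      = mvfderiv 𝓘(ℝ, E) (fun y : G => oneChart E G ((oneChart E G).symm x * y)) 1 X := by
  have hchart := hm.hasFDerivAt.comp (f := fun y => (x, y)) _ (hasFDerivAt_prodMk_right x _)
  exact congrArg (fun T : E →L[ℝ] E => T (lieModel X)) (hchart.unique
    (hasFDerivAt_comp_symm_chartOne (mdifferentiableAt_chart_mul_left (symm_mem_source hx))))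

theorem fderiv_chartMul_inl {x : E} (hx : x ∈ (oneChart E G).target)
    (hm : DifferentiableAt ℝ (chartMul E G) (chartOne E G, x))
    (X : GroupLieAlgebra 𝓘(ℝ, E) G) :
    fderiv ℝ (chartMul E G) (chartOne E G, x) (lieModel X, 0)
      = mvfderiv 𝓘(ℝ, E) (fun y : G => oneChart E G (y * (oneChart E G).symm x)) 1 X := by
  have hchart := hm.hasFDerivAt.comp (f := fun y => (y, x)) _ (hasFDerivAt_prodMk_left _ x)
  exact congrArg (fun T : E →L[ℝ] E => T (lieModel X)) (hchart.unique
    (hasFDerivAt_comp_symm_chartOne (mdifferentiableAt_chart_mul_right (symm_mem_source hx))))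

theorem eventually_mem_target_and_differentiableAt_chartMul :
    ∀ᶠ x in 𝓝 (chartOne E G), x ∈ (oneChart E G).target ∧
      DifferentiableAt ℝ (chartMul E G) (x, chartOne E G) ∧
      DifferentiableAt ℝ (chartMul E G) (chartOne E G, x) := by
  have hdiff : ∀ᶠ p in 𝓝 (chartOne E G, chartOne E G), DifferentiableAt ℝ (chartMul E G) p :=
    ((contDiffAt_chartMul.of_le (m := 1) (by simp)).eventually (by simp)).mono
      fun p hp => hp.differentiableAt (by simp)
  exact (eventually_mem_set.mpr target_mem_nhds_chartOne).and
    (((Continuous.prodMk_left (chartOne E G)).tendsto _ |>.eventually hdiff).and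
      ((Continuous.prodMk_right (chartOne E G)).tendsto _ |>.eventually hdiff))

theorem eventually_fderiv_chartMul_inr_eq_inl (X : GroupLieAlgebra 𝓘(ℝ, E) G) :
    ∀ᶠ x in 𝓝 (chartOne E G),
      fderiv ℝ (chartMul E G) (x, chartOne E G) (0, lieModel X)
        = fderiv ℝ (chartMul E G) (chartOne E G, x)
          (lieModel (adjoint ((oneChart E G).symm x) X), 0) := by
  have : IsManifold 𝓘(ℝ, E) 1 G := inferInstance
  filter_upwards [eventually_mem_target_and_differentiableAt_chartMul] with x ⟨hx, hl, hr⟩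
  rw [fderiv_chartMul_inr hx hl, fderiv_chartMul_inl hx hr]
  exact mvfderiv_comp_mul_left_one (mdifferentiableAt_extChartAt (symm_mem_source hx)) X

theorem mvfderiv_chart_one (X : GroupLieAlgebra 𝓘(ℝ, E) G) :
    mvfderiv 𝓘(ℝ, E) (oneChart E G) 1 X = lieModel X :=
  have : IsManifold 𝓘(ℝ, E) 1 G := inferInstance
  congrArg (fun T : E →L[ℝ] E => T (lieModel X)) (mfderiv_extChartAt_self (I := 𝓘(ℝ, E)))

theorem fderiv_chartMul_chartOne_inl (v : E) :
    fderiv ℝ (chartMul E G) (chartOne E G, chartOne E G) (v, 0) = v := by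
  obtain ⟨X, rfl⟩ := (lieModel (G := G)).surjective v
  rw [fderiv_chartMul_inl (mem_of_mem_nhds target_mem_nhds_chartOne)
    (contDiffAt_chartMul.differentiableAt (by simp))]
  simp only [symm_chartOne, mul_one]
  exact mvfderiv_chart_one X

theorem fderiv_chartMul_chartOne_inr (v : E) :
    fderiv ℝ (chartMul E G) (chartOne E G, chartOne E G) (0, v) = v := by
  obtain ⟨X, rfl⟩ := (lieModel (G := G)).surjective v
  rw [fderiv_chartMul_inr (mem_of_mem_nhds target_mem_nhds_chartOne)
    (contDiffAt_chartMul.differentiableAt (by simp))]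
  simp only [symm_chartOne, one_mul]
  exact mvfderiv_chart_one X

variable (E G) in
/-- The second derivative at the identity of the multiplication of `G`, read in the preferred
chart. -/
def chartMulHessian : E × E →L[ℝ] E × E →L[ℝ] E :=
  fderiv ℝ (fderiv ℝ (chartMul E G)) (chartOne E G, chartOne E G)

theorem hasFDerivAt_fderiv_chartMul :
    HasFDerivAt (fderiv ℝ (chartMul E G)) (chartMulHessian E G) (chartOne E G, chartOne E G) :=
  ((contDiffAt_chartMul.fderiv_right (m := ∞) (by simp)).differentiableAt (by simp)).hasFDerivAt

theorem chartMulHessian_comm (p q : E × E) :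
    chartMulHessian E G p q = chartMulHessian E G q p :=
  contDiffAt_chartMul.isSymmSndFDerivAt
    (by rw [minSmoothness_of_isRCLikeNormedField]; exact WithTop.coe_le_coe.2 le_top) p q

theorem hasFDerivAt_fderiv_chartMul_inr (v : E) :
    HasFDerivAt (fun x => fderiv ℝ (chartMul E G) (x, chartOne E G) (0, v))
      ((chartMulHessian E G).flip (0, v) ∘L .inl ℝ E E) (chartOne E G) := by
  have h := (hasFDerivAt_fderiv_chartMul.comp (f := fun x => (x, chartOne E G)) _
    (hasFDerivAt_prodMk_left _ (chartOne E G))).clm_apply (hasFDerivAt_const ((0 : E), v) _)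
  refine h.congr_fderiv ?_
  ext w
  simp

theorem mvfderiv_lieModel_adjoint_eq_chartMulHessian (A X : GroupLieAlgebra 𝓘(ℝ, E) G) :
    mvfderiv 𝓘(ℝ, E) (fun g : G => lieModel (adjoint g X)) 1 A
      = chartMulHessian E G (lieModel A, 0) (0, lieModel X)
        - chartMulHessian E G (lieModel X, 0) (0, lieModel A) := by
  set D : E →L[ℝ] E := mvfderiv 𝓘(ℝ, E) (fun g : G => lieModel (adjoint g X)) 1 with hD
  have hAd := hasFDerivAt_comp_symm_chartOne
    ((contMDiff_adjoint_apply X).mdifferentiable (by simp) (1 : G))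
  rw [← hD] at hAd
  have hright := (hasFDerivAt_fderiv_chartMul.comp (f := fun x => (chartOne E G, x)) _
    (hasFDerivAt_prodMk_right (chartOne E G) _)).clm_apply
      (hAd.prodMk (hasFDerivAt_const (0 : E) _))
  have hAd_one : lieModel (adjoint ((oneChart E G).symm (chartOne E G)) X) = lieModel X := by
    rw [symm_chartOne, adjoint_one]; rfl
  have heq := congrArg (fun T : E →L[ℝ] E => T (lieModel A))
    ((hasFDerivAt_fderiv_chartMul_inr (lieModel X)).unique
      (hright.congr_of_eventuallyEq (eventually_fderiv_chartMul_inr_eq_inl X)))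
  simp only [Function.comp_apply, hAd_one, add_apply, ContinuousLinearMap.comp_apply,
    ContinuousLinearMap.flip_apply, ContinuousLinearMap.inl_apply, ContinuousLinearMap.inr_apply,
    ContinuousLinearMap.prod_apply, zero_apply, fderiv_chartMul_chartOne_inl] at heq
  rw [heq, chartMulHessian_comm (lieModel X, 0), add_sub_cancel_right]
  rfl

theorem mpullbackWithin_mulInvariantVectorField_eventuallyEq (X : GroupLieAlgebra 𝓘(ℝ, E) G) :
    (fun x => (VectorField.mpullbackWithin 𝓘(ℝ, E) 𝓘(ℝ, E) (oneChart E G).symm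
        (mulInvariantVectorField X) (Set.range 𝓘(ℝ, E)) x : E))
      =ᶠ[𝓝 (chartOne E G)] fun x => fderiv ℝ (chartMul E G) (x, chartOne E G) (0, lieModel X) := by
  have : IsManifold 𝓘(ℝ, E) 1 G := inferInstance
  filter_upwards [eventually_mem_target_and_differentiableAt_chartMul] with x ⟨hx, hm, _⟩
  rw [fderiv_chartMul_inr hx hm, VectorField.mpullbackWithin_apply,
    ContinuousLinearMap.inverse_eq
      (mfderivWithin_extChartAt_symm_comp_mfderiv_extChartAt hx)
      (mfderiv_extChartAt_comp_mfderivWithin_extChartAt_symm hx)]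
  exact (mvfderiv_comp_mul_left (mdifferentiableAt_extChartAt (symm_mem_source hx)) X).symm

theorem lieModel_lie_eq_chartMulHessian (A X : GroupLieAlgebra 𝓘(ℝ, E) G) :
    lieModel ⁅A, X⁆
      = chartMulHessian E G (lieModel A, 0) (0, lieModel X)
        - chartMulHessian E G (lieModel X, 0) (0, lieModel A) := by
  have : IsManifold 𝓘(ℝ, E) 1 G := inferInstance
  let V (X : GroupLieAlgebra 𝓘(ℝ, E) G) : E → E := VectorField.mpullbackWithin 𝓘(ℝ, E) 𝓘(ℝ, E)
    (oneChart E G).symm (mulInvariantVectorField X) (Set.range 𝓘(ℝ, E))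
  have hV (X : GroupLieAlgebra 𝓘(ℝ, E) G) : V X =ᶠ[𝓝 (chartOne E G)]
      fun x => fderiv ℝ (chartMul E G) (x, chartOne E G) (0, lieModel X) :=
    mpullbackWithin_mulInvariantVectorField_eventuallyEq X
  have hbracket : lieModel ⁅A, X⁆ = VectorField.lieBracket ℝ (V A) (V X) (chartOne E G) := by
    rw [GroupLieAlgebra.bracket_def, ← VectorField.mlieBracketWithin_univ,
      VectorField.mlieBracketWithin_apply, mfderiv_extChartAt_self]
    change (ContinuousLinearMap.id ℝ E).inverse _ = _
    rw [ContinuousLinearMap.inverse_id, ← VectorField.lieBracketWithin_univ]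
    simp only [V, Set.preimage_univ, Set.univ_inter, modelWithCornersSelf_coe, Set.range_id]
    rfl
  rw [hbracket, (hV A).lieBracket_vectorField_eq (hV X), VectorField.lieBracket,
    (hasFDerivAt_fderiv_chartMul_inr _).fderiv, (hasFDerivAt_fderiv_chartMul_inr _).fderiv,
    fderiv_chartMul_chartOne_inr, fderiv_chartMul_chartOne_inr]
  rfl

theorem mvfderiv_lieModel_adjoint_one (A X : GroupLieAlgebra 𝓘(ℝ, E) G) :
    mvfderiv 𝓘(ℝ, E) (fun g : G => lieModel (adjoint g X)) 1 A = lieModel ⁅A, X⁆ := by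
  rw [mvfderiv_lieModel_adjoint_eq_chartMulHessian, lieModel_lie_eq_chartMulHessian]

end ChartAtOne

section ZeroDerivative

variable {E : Type*} [NormedAddCommGroup E] [NormedSpace ℝ E]
  {M : Type*} [TopologicalSpace M] [ChartedSpace E M] [IsManifold 𝓘(ℝ, E) 1 M]
  {V : Type*} [NormedAddCommGroup V] [NormedSpace ℝ V] {f : M → V}

theorem hasFDerivAt_comp_extChartAt_symm (hf : MDifferentiable 𝓘(ℝ, E) 𝓘(ℝ, V) f)
    (hf' : ∀ x, mvfderiv 𝓘(ℝ, E) f x = 0) {x : M} {y : E}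
    (hy : y ∈ (extChartAt 𝓘(ℝ, E) x).target) :
    HasFDerivAt (f ∘ (extChartAt 𝓘(ℝ, E) x).symm) (0 : E →L[ℝ] V) y := by
  have hφ : MDifferentiableAt 𝓘(ℝ, E) 𝓘(ℝ, E) (extChartAt 𝓘(ℝ, E) x).symm y :=
    ((contMDiffOn_extChartAt_symm (n := 1) x).contMDiffAt
      ((isOpen_extChartAt_target x).mem_nhds hy)).mdifferentiableAt (by simp)
  refine (hasMFDerivAt_iff_hasFDerivAt.mp <| HasMFDerivAt.comp (I' := 𝓘(ℝ, E)) y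
    (hf _).hasMFDerivAt hφ.hasMFDerivAt).congr_fderiv ?_
  ext v
  exact DFunLike.congr_fun (hf' _) (mfderiv 𝓘(ℝ, E) 𝓘(ℝ, E) (extChartAt 𝓘(ℝ, E) x).symm y v)

theorem isLocallyConstant_of_mvfderiv_eq_zero (hf : MDifferentiable 𝓘(ℝ, E) 𝓘(ℝ, V) f)
    (hf' : ∀ x, mvfderiv 𝓘(ℝ, E) f x = 0) : IsLocallyConstant f := by
  intro s
  refine isOpen_iff_mem_nhds.mpr fun x hx => ?_
  have hopen : IsOpen ((extChartAt 𝓘(ℝ, E) x).target ∩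
      (f ∘ (extChartAt 𝓘(ℝ, E) x).symm) ⁻¹' s) :=
    (isOpen_extChartAt_target x).isOpen_inter_preimage_of_fderiv_eq_zero (𝕜 := ℝ)
      (fun y hy => (hasFDerivAt_comp_extChartAt_symm hf hf' hy).differentiableAt
        |>.differentiableWithinAt)
      (fun y hy => (hasFDerivAt_comp_extChartAt_symm hf hf' hy).fderiv) s
  have hmem := (continuousAt_extChartAt (I := 𝓘(ℝ, E)) x).preimage_mem_nhds (hopen.mem_nhds
    ⟨mem_extChartAt_target x, by simpa only [Set.mem_preimage, Function.comp_apply,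
      extChartAt_to_inv] using hx⟩)
  filter_upwards [hmem, extChartAt_source_mem_nhds (I := 𝓘(ℝ, E)) x] with y hy hysource
  simpa only [Set.mem_preimage, Function.comp_apply, (extChartAt 𝓘(ℝ, E) x).left_inv hysource]
    using hy.2

end ZeroDerivative

section LeftInvariantDerivative

variable {E : Type*} [NormedAddCommGroup E] [NormedSpace ℝ E]
  {G : Type*} [TopologicalSpace G] [ChartedSpace E G] [Group G]

theorem leftDeriv_add_left (X Y : GroupLieAlgebra 𝓘(ℝ, E) G) (f : G → ℝ) :
    leftDeriv (X + Y) f = leftDeriv X f + leftDeriv Y f := by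
  ext g
  simp only [leftDeriv, mulInvariantVectorField_add, Pi.add_apply, map_add]
  rfl

theorem leftDeriv_smul_left (c : ℝ) (X : GroupLieAlgebra 𝓘(ℝ, E) G) (f : G → ℝ) :
    leftDeriv (c • X) f = c • leftDeriv X f := by
  ext g
  simp only [leftDeriv, mulInvariantVectorField_smul, Pi.smul_apply, map_smul]
  rfl

theorem leftDeriv_zero_left (f : G → ℝ) :
    leftDeriv (0 : GroupLieAlgebra 𝓘(ℝ, E) G) f = 0 := by
  simpa only [zero_smul] using leftDeriv_smul_left 0 (0 : GroupLieAlgebra 𝓘(ℝ, E) G) f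

theorem leftDeriv_add {f₁ f₂ : G → ℝ} (h₁ : MDifferentiable 𝓘(ℝ, E) 𝓘(ℝ, ℝ) f₁)
    (h₂ : MDifferentiable 𝓘(ℝ, E) 𝓘(ℝ, ℝ) f₂) (X : GroupLieAlgebra 𝓘(ℝ, E) G) :
    leftDeriv X (f₁ + f₂) = leftDeriv X f₁ + leftDeriv X f₂ :=
  funext fun g => DFunLike.congr_fun (mvfderiv_add (h₁ g) (h₂ g)) _

theorem leftDeriv_const_smul {f : G → ℝ} (hf : MDifferentiable 𝓘(ℝ, E) 𝓘(ℝ, ℝ) f) (c : ℝ)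
    (X : GroupLieAlgebra 𝓘(ℝ, E) G) : leftDeriv X (c • f) = c • leftDeriv X f :=
  funext fun g => DFunLike.congr_fun (hf g |>.hasMFDerivAt.const_smul c).mfderiv _

theorem leftDeriv_mul {f₁ f₂ : G → ℝ} (h₁ : MDifferentiable 𝓘(ℝ, E) 𝓘(ℝ, ℝ) f₁)
    (h₂ : MDifferentiable 𝓘(ℝ, E) 𝓘(ℝ, ℝ) f₂) (X : GroupLieAlgebra 𝓘(ℝ, E) G) :
    leftDeriv X (f₁ * f₂) = f₁ * leftDeriv X f₂ + f₂ * leftDeriv X f₁ :=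
  funext fun g => DFunLike.congr_fun ((h₁ g).hasMFDerivAt.mul (h₂ g).hasMFDerivAt).mfderiv _

variable [LieGroup 𝓘(ℝ, E) ∞ G]

theorem leftDeriv_comp_mul_left {f : G → ℝ} (hf : MDifferentiable 𝓘(ℝ, E) 𝓘(ℝ, ℝ) f)
    (g h : G) (X : GroupLieAlgebra 𝓘(ℝ, E) G) :
    leftDeriv X (fun x => f (g * x)) h = leftDeriv X f (g * h) := by
  have hfg : MDifferentiableAt 𝓘(ℝ, E) 𝓘(ℝ, ℝ) (fun x => f (g * x)) h :=
    MDifferentiableAt.comp (I' := 𝓘(ℝ, E)) h (hf _) (mdifferentiable_mul_left g h)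
  refine (mvfderiv_comp_mul_left hfg X).symm.trans (Eq.trans ?_ (mvfderiv_comp_mul_left (hf _) X))
  simp only [mul_assoc]

/-- The bound on `m` is the smoothness that Mathlib provides for left invariant vector fields. -/
theorem contMDiff_leftDeriv {m n : WithTop ℕ∞} {f : G → ℝ}
    (hf : ContMDiff 𝓘(ℝ, E) 𝓘(ℝ, ℝ) n f) (hmn : m + 1 ≤ n) (hm : m ≤ 2)
    (X : GroupLieAlgebra 𝓘(ℝ, E) G) : ContMDiff 𝓘(ℝ, E) 𝓘(ℝ, ℝ) m (leftDeriv X f) := by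
  have : IsManifold 𝓘(ℝ, E) 1 G := inferInstance
  have hX := (contMDiff_mulInvariantVectorField (I := 𝓘(ℝ, E)) (G := G) X).of_le (m := m)
    (by rwa [minSmoothness_of_isRCLikeNormedField])
  exact (contMDiff_snd_tangentBundle_modelSpace ℝ 𝓘(ℝ, ℝ)).comp
    ((hf.contMDiff_tangentMap hmn).comp hX)

theorem continuous_leftDeriv {f : G → ℝ} (hf : ContMDiff 𝓘(ℝ, E) 𝓘(ℝ, ℝ) 1 f)
    (X : GroupLieAlgebra 𝓘(ℝ, E) G) : Continuous (leftDeriv X f) :=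
  (contMDiff_leftDeriv (m := 0) hf (by simp) (by simp) X).continuous

theorem mulInvariantVectorField_surjective (g : G) :
    Function.Surjective
      (fun X : GroupLieAlgebra 𝓘(ℝ, E) G => mulInvariantVectorField X g) := by
  intro v
  have hid : (fun x => g * x) ∘ (fun x => g⁻¹ * x) = (id : G → G) := by ext; simp
  have hcomp := mfderiv_comp_apply_of_eq (I := 𝓘(ℝ, E)) (I' := 𝓘(ℝ, E)) (I'' := 𝓘(ℝ, E)) g
    (mdifferentiable_mul_left g 1) (mdifferentiable_mul_left g⁻¹ g) (inv_mul_cancel g) v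
  rw [hid, mfderiv_id] at hcomp
  exact ⟨_, hcomp.symm⟩

theorem eq_of_mvfderiv_mulInvariantVectorField_eq_zero [PreconnectedSpace G]
    {V : Type*} [NormedAddCommGroup V] [NormedSpace ℝ V] {f : G → V}
    (hf : MDifferentiable 𝓘(ℝ, E) 𝓘(ℝ, V) f)
    (hf' : ∀ X g, mvfderiv 𝓘(ℝ, E) f g (mulInvariantVectorField X g) = 0) (g h : G) :
    f g = f h := by
  have : IsManifold 𝓘(ℝ, E) 1 G := inferInstance
  refine (isLocallyConstant_of_mvfderiv_eq_zero hf fun x => ?_).apply_eq_of_preconnectedSpace g h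
  ext v
  obtain ⟨X, rfl⟩ := mulInvariantVectorField_surjective x v
  exact hf' X x

end LeftInvariantDerivative

section IntegrationByParts

open MeasureTheory

variable {E : Type*} [NormedAddCommGroup E] [NormedSpace ℝ E]
  {G : Type*} [TopologicalSpace G] [ChartedSpace E G] [Group G] [LieGroup 𝓘(ℝ, E) ∞ G]

theorem hasDerivAt_comp_mul_of_hasMFDerivAt {f : G → ℝ} (hf : MDifferentiable 𝓘(ℝ, E) 𝓘(ℝ, ℝ) f)
    {X : GroupLieAlgebra 𝓘(ℝ, E) G} {γ : ℝ → G} {t : ℝ}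
    (hγ : HasMFDerivAt 𝓘(ℝ, ℝ) 𝓘(ℝ, E) γ t
      ((1 : ℝ →L[ℝ] ℝ).smulRight (mulInvariantVectorField X (γ t)))) (g : G) :
    HasDerivAt (fun s => f (g * γ s)) (leftDeriv X f (g * γ t)) t := by
  have hfg : MDifferentiableAt 𝓘(ℝ, E) 𝓘(ℝ, ℝ) (fun x => f (g * x)) (γ t) :=
    MDifferentiableAt.comp (I' := 𝓘(ℝ, E)) (γ t) (hf _) (mdifferentiable_mul_left g _)
  have hderiv : HasFDerivAt (fun s => f (g * γ s))
      ((mvfderiv 𝓘(ℝ, E) (fun x => f (g * x)) (γ t) : E →L[ℝ] ℝ).comp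
        ((1 : ℝ →L[ℝ] ℝ).smulRight (mulInvariantVectorField X (γ t) : E))) t :=
    hasMFDerivAt_iff_hasFDerivAt.mp
      (HasMFDerivAt.comp (g := fun x => f (g * x)) t hfg.hasMFDerivAt hγ)
  rw [← leftDeriv_comp_mul_left hf]
  refine hderiv.hasDerivAt.congr_deriv ?_
  exact congrArg (mfderiv 𝓘(ℝ, E) 𝓘(ℝ, ℝ) (fun x => f (g * x)) (γ t))
    (one_smul ℝ (mulInvariantVectorField X (γ t)))

variable [MeasurableSpace G] [BorelSpace G] {μ : Measure G} [IsFiniteMeasure μ]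
  [μ.IsMulRightInvariant]

/-- Right translation by an integral curve of a left invariant field preserves the integral. -/
theorem integral_leftDeriv_eq_zero [CompleteSpace E] [CompactSpace G] {f : G → ℝ}
    (hf : ContMDiff 𝓘(ℝ, E) 𝓘(ℝ, ℝ) 1 f) (X : GroupLieAlgebra 𝓘(ℝ, E) G) :
    ∫ g, leftDeriv X f g ∂μ = 0 := by
  have : IsManifold 𝓘(ℝ, E) 1 G := inferInstance
  have : IsTopologicalGroup G := topologicalGroup_of_lieGroup 𝓘(ℝ, E) ∞
  have hX : ContMDiffAt 𝓘(ℝ, E) 𝓘(ℝ, E).tangent 1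
      (fun g => (⟨g, mulInvariantVectorField X g⟩ : TangentBundle 𝓘(ℝ, E) G)) 1 :=
    ((contMDiff_mulInvariantVectorField (I := 𝓘(ℝ, E)) (G := G) X).of_le
      (by rw [minSmoothness_of_isRCLikeNormedField]; norm_num)).contMDiffAt
  obtain ⟨γ, hγ0, hγ⟩ := exists_isMIntegralCurveAt_of_contMDiffAt_boundaryless (0 : ℝ) hX
  have hcont := continuous_leftDeriv hf X
  have htranslate : ∀ t, Continuous (fun g => f (g * γ t)) := fun t =>
    hf.continuous.comp (continuous_mul_const _)
  obtain ⟨C, hC⟩ := isCompact_univ.exists_bound_of_continuousOn hcont.continuousOn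
  have hderiv : HasDerivAt (fun t => ∫ g, f (g * γ t) ∂μ) (∫ g, leftDeriv X f (g * γ 0) ∂μ) 0 :=
    (hasDerivAt_integral_of_dominated_loc_of_deriv_le hγ
      (.of_forall fun t => (htranslate t).aestronglyMeasurable)
      ((htranslate 0).integrable_of_hasCompactSupport (.of_compactSpace _))
      (hcont.comp (continuous_mul_const _)).aestronglyMeasurable
      (.of_forall fun g t _ => hC _ (Set.mem_univ _)) (integrable_const C)
      (.of_forall fun g t ht => hasDerivAt_comp_mul_of_hasMFDerivAt
        (hf.mdifferentiable (by simp)) ht g)).2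
  simp only [integral_mul_right_eq_self (fun g => f g), hγ0, mul_one] at hderiv
  exact hderiv.unique (hasDerivAt_const _ _)

theorem integral_leftDeriv_mul [CompleteSpace E] [CompactSpace G] {f₁ f₂ : G → ℝ}
    (h₁ : ContMDiff 𝓘(ℝ, E) 𝓘(ℝ, ℝ) 1 f₁) (h₂ : ContMDiff 𝓘(ℝ, E) 𝓘(ℝ, ℝ) 1 f₂)
    (X : GroupLieAlgebra 𝓘(ℝ, E) G) :
    ∫ g, leftDeriv X f₁ g * f₂ g ∂μ = -∫ g, f₁ g * leftDeriv X f₂ g ∂μ := by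
  have hmul := leftDeriv_mul (h₁.mdifferentiable (by simp)) (h₂.mdifferentiable (by simp)) X
  have hint₁ : Integrable (fun g => f₁ g * leftDeriv X f₂ g) μ :=
    (h₁.continuous.mul (continuous_leftDeriv h₂ X)).integrable_of_hasCompactSupport
      (.of_compactSpace _)
  have hint₂ : Integrable (fun g => leftDeriv X f₁ g * f₂ g) μ :=
    ((continuous_leftDeriv h₁ X).mul h₂.continuous).integrable_of_hasCompactSupport
      (.of_compactSpace _)
  rw [eq_neg_iff_add_eq_zero, ← integral_add hint₂ hint₁,
    ← integral_leftDeriv_eq_zero (μ := μ) (h₁.mul h₂) X]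
  refine integral_congr_ae (.of_forall fun g => ?_)
  refine Eq.trans ?_ (congrFun hmul g).symm
  simp only [Pi.add_apply, Pi.mul_apply]
  ring

theorem integral_hormanderOp_mul [CompleteSpace E] [CompactSpace G] {f₁ f₂ : G → ℝ}
    (h₁ : ContMDiff 𝓘(ℝ, E) 𝓘(ℝ, ℝ) 2 f₁) (h₂ : ContMDiff 𝓘(ℝ, E) 𝓘(ℝ, ℝ) 2 f₂)
    {N : ℕ} (A : Fin N → GroupLieAlgebra 𝓘(ℝ, E) G) :
    ∫ g, hormanderOp 0 A f₁ g * f₂ g ∂μ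
      = -(1 / 2 * ∑ k, ∫ g, leftDeriv (A k) f₁ g * leftDeriv (A k) f₂ g ∂μ) := by
  have hA₁ : ∀ k, ContMDiff 𝓘(ℝ, E) 𝓘(ℝ, ℝ) 1 (leftDeriv (A k) f₁) := fun k =>
    contMDiff_leftDeriv h₁ (by norm_num) (by norm_num) (A k)
  have hint : ∀ k, Integrable (fun g => leftDeriv (A k) (leftDeriv (A k) f₁) g * f₂ g) μ := fun k =>
    ((continuous_leftDeriv (hA₁ k) (A k)).mul h₂.continuous).integrable_of_hasCompactSupport
      (.of_compactSpace _)
  simp only [hormanderOp, leftDeriv_zero_left, Pi.zero_apply, add_zero, mul_assoc, Finset.sum_mul,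
    integral_const_mul]
  rw [integral_finsetSum _ fun k _ => hint k]
  simp only [integral_leftDeriv_mul (hA₁ _) (h₂.of_le one_le_two), Finset.sum_neg_distrib, mul_neg]

theorem integral_hormanderOp_mul_comm [CompleteSpace E] [CompactSpace G] {f₁ f₂ : G → ℝ}
    (h₁ : ContMDiff 𝓘(ℝ, E) 𝓘(ℝ, ℝ) 2 f₁) (h₂ : ContMDiff 𝓘(ℝ, E) 𝓘(ℝ, ℝ) 2 f₂)
    {N : ℕ} (A : Fin N → GroupLieAlgebra 𝓘(ℝ, E) G) :
    ∫ g, hormanderOp 0 A f₁ g * f₂ g ∂μ = ∫ g, f₁ g * hormanderOp 0 A f₂ g ∂μ := by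
  simp only [mul_comm (f₁ _), integral_hormanderOp_mul h₁ h₂, integral_hormanderOp_mul h₂ h₁,
    mul_comm (leftDeriv _ f₂ _)]

end IntegrationByParts

section AdjointRestriction

variable {E : Type*} [NormedAddCommGroup E] [NormedSpace ℝ E]
  {G : Type*} [TopologicalSpace G] [ChartedSpace E G] [Group G] [LieGroup 𝓘(ℝ, E) ∞ G]
  {F : Type*} [NormedAddCommGroup F] [NormedSpace ℝ F]
  {H : Subgroup G} [ChartedSpace F H]
  {V : Type*} [NormedAddCommGroup V] [NormedSpace ℝ V]

theorem contMDiff_clm_adjoint_apply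
    (hι : ContMDiff 𝓘(ℝ, F) 𝓘(ℝ, E) ∞ (Subtype.val : H → G))
    (T : GroupLieAlgebra 𝓘(ℝ, E) G →L[ℝ] V) (X : GroupLieAlgebra 𝓘(ℝ, E) G) :
    ContMDiff 𝓘(ℝ, F) 𝓘(ℝ, V) ∞ (fun h : H => T (adjoint (h : G) X)) :=
  (T.comp (lieModel (G := G)).symm.toContinuousLinearMap).contDiff.contMDiff.comp
    ((contMDiff_adjoint_apply X).comp hι)

theorem mvfderiv_clm_adjoint_apply_one
    (hι : ContMDiff 𝓘(ℝ, F) 𝓘(ℝ, E) ∞ (Subtype.val : H → G))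
    (T : GroupLieAlgebra 𝓘(ℝ, E) G →L[ℝ] V) (A : GroupLieAlgebra 𝓘(ℝ, F) H)
    (X : GroupLieAlgebra 𝓘(ℝ, E) G) :
    mvfderiv 𝓘(ℝ, F) (fun h : H => T (adjoint (h : G) X)) 1 A
      = T ⁅(lieIncl H A : GroupLieAlgebra 𝓘(ℝ, E) G), X⁆ := by
  let S : E →L[ℝ] V := T.comp (lieModel (G := G)).symm.toContinuousLinearMap
  let Ad : G → E := fun g => lieModel (adjoint g X)
  have hAd : MDifferentiableAt 𝓘(ℝ, E) 𝓘(ℝ, E) Ad 1 :=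
    (contMDiff_adjoint_apply X).mdifferentiable (by simp) 1
  have hAdι : HasMFDerivAt 𝓘(ℝ, F) 𝓘(ℝ, E) (Ad ∘ Subtype.val) (1 : H)
      ((mfderiv 𝓘(ℝ, E) 𝓘(ℝ, E) Ad 1).comp (lieIncl H)) :=
    HasMFDerivAt.comp (I' := 𝓘(ℝ, E)) (1 : H) hAd.hasMFDerivAt
      (hι.mdifferentiable (by simp) 1).hasMFDerivAt
  refine (DFunLike.congr_fun (S.hasMFDerivAt.comp (1 : H) hAdι).mfderiv A).trans ?_
  exact congrArg S (mvfderiv_lieModel_adjoint_one (lieIncl H A) X)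

variable [LieGroup 𝓘(ℝ, F) ∞ H]

theorem mvfderiv_clm_adjoint_apply
    (hι : ContMDiff 𝓘(ℝ, F) 𝓘(ℝ, E) ∞ (Subtype.val : H → G))
    (T : GroupLieAlgebra 𝓘(ℝ, E) G →L[ℝ] V) (A : GroupLieAlgebra 𝓘(ℝ, F) H)
    (X : GroupLieAlgebra 𝓘(ℝ, E) G) (h : H) :
    mvfderiv 𝓘(ℝ, F) (fun h : H => T (adjoint (h : G) X)) h (mulInvariantVectorField A h)
      = T (adjoint (h : G) ⁅(lieIncl H A : GroupLieAlgebra 𝓘(ℝ, E) G), X⁆) := by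
  rw [← mvfderiv_comp_mul_left ((contMDiff_clm_adjoint_apply hι T X).mdifferentiable (by simp) h)]
  simp only [Subgroup.coe_mul, adjoint_mul_apply]
  exact mvfderiv_clm_adjoint_apply_one hι (T.comp (adjoint (h : G))) A X

theorem adjoint_eq_self_of_forall_lie_eq_zero [PreconnectedSpace H]
    (hι : ContMDiff 𝓘(ℝ, F) 𝓘(ℝ, E) ∞ (Subtype.val : H → G)) {X : GroupLieAlgebra 𝓘(ℝ, E) G}
    (hX : ∀ A : GroupLieAlgebra 𝓘(ℝ, F) H,
      ⁅(lieIncl H A : GroupLieAlgebra 𝓘(ℝ, E) G), X⁆ = 0) (h : H) :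
    adjoint (h : G) X = X := by
  have hconst := eq_of_mvfderiv_mulInvariantVectorField_eq_zero
    ((contMDiff_clm_adjoint_apply hι lieModel.toContinuousLinearMap X).mdifferentiable (by simp))
    (fun A g => by rw [mvfderiv_clm_adjoint_apply hι, hX, map_zero, map_zero]) h 1
  simpa only [OneMemClass.coe_one, adjoint_one, one_apply_eq_self]
    using lieModel.injective hconst

end AdjointRestriction

section InfinitesimalInvariance

variable {E : Type*} [NormedAddCommGroup E] [NormedSpace ℝ E]
  {G : Type*} [TopologicalSpace G] [ChartedSpace E G] [Group G]
  {H : Subgroup G} {B : LinearMap.BilinForm ℝ (GroupLieAlgebra 𝓘(ℝ, E) G)}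

theorem IsAdInvariantInner.apply_adjoint_le (hB : IsAdInvariantInner H B) (h : H)
    (X : GroupLieAlgebra 𝓘(ℝ, E) G) : B (adjoint (h : G) X) X ≤ B X X := by
  have hnonneg : 0 ≤ B (adjoint (h : G) X - X) (adjoint (h : G) X - X) := by
    rcases eq_or_ne (adjoint (h : G) X - X) 0 with h0 | h0
    · rw [h0, map_zero]
    · exact (hB.pos _ h0).le
  simp only [map_sub, LinearMap.sub_apply, hB.invariant h h.2, hB.symm X] at hnonneg
  linarith

variable [LieGroup 𝓘(ℝ, E) ∞ G]
  {F : Type*} [NormedAddCommGroup F] [NormedSpace ℝ F] [ChartedSpace F H]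

theorem adjoint_lie_of_comm (hι : ContMDiff 𝓘(ℝ, F) 𝓘(ℝ, E) ∞ (Subtype.val : H → G))
    {g : G} (hg : ∀ h ∈ H, g * h = h * g) (A : GroupLieAlgebra 𝓘(ℝ, F) H)
    (X : GroupLieAlgebra 𝓘(ℝ, E) G) :
    adjoint g ⁅(lieIncl H A : GroupLieAlgebra 𝓘(ℝ, E) G), X⁆
      = ⁅(lieIncl H A : GroupLieAlgebra 𝓘(ℝ, E) G), adjoint g X⁆ := by
  refine lieModel.injective ?_
  have hleft := mvfderiv_clm_adjoint_apply_one hι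
    (lieModel.toContinuousLinearMap.comp (adjoint g)) A X
  have hright := mvfderiv_clm_adjoint_apply_one hι
    lieModel.toContinuousLinearMap A (adjoint g X)
  refine (hleft.symm.trans ?_).trans hright
  congr! 3 with h
  simp only [ContinuousLinearMap.comp_apply, ← adjoint_mul_apply, hg h h.2]

variable [FiniteDimensional ℝ E]

instance finiteDimensional_groupLieAlgebra : FiniteDimensional ℝ (GroupLieAlgebra 𝓘(ℝ, E) G) :=
  inferInstanceAs (FiniteDimensional ℝ E)

instance t2Space_groupLieAlgebra : T2Space (GroupLieAlgebra 𝓘(ℝ, E) G) :=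
  inferInstanceAs (T2Space E)

theorem lieIncl_lie_mem (hι : ContMDiff 𝓘(ℝ, F) 𝓘(ℝ, E) ∞ (Subtype.val : H → G))
    {W : Submodule ℝ (GroupLieAlgebra 𝓘(ℝ, E) G)} (hW : IsAdInvariant H W)
    (A : GroupLieAlgebra 𝓘(ℝ, F) H) {X : GroupLieAlgebra 𝓘(ℝ, E) G} (hX : X ∈ W) :
    ⁅(lieIncl H A : GroupLieAlgebra 𝓘(ℝ, E) G), X⁆ ∈ W := by
  refine (Subspace.forall_mem_dualAnnihilator_apply_eq_zero_iff W _).mp fun φ hφ => ?_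
  have hzero : (fun h : H => φ.toContinuousLinearMap (adjoint (h : G) X)) = fun _ => 0 :=
    funext fun h => (Submodule.mem_dualAnnihilator φ).mp hφ _ (hW h h.2 X hX)
  have hderiv := mvfderiv_clm_adjoint_apply_one hι φ.toContinuousLinearMap A X
  rw [hzero, mvfderiv_const] at hderiv
  exact hderiv.symm

/-- `h ↦ B (Ad h X) X` is maximal at the identity, so its derivative vanishes there. -/
theorem IsAdInvariantInner.lieIncl_lie_self
    (hB : IsAdInvariantInner H B)
    (hι : ContMDiff 𝓘(ℝ, F) 𝓘(ℝ, E) ∞ (Subtype.val : H → G))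
    (A : GroupLieAlgebra 𝓘(ℝ, F) H) (X : GroupLieAlgebra 𝓘(ℝ, E) G) :
    B ⁅(lieIncl H A : GroupLieAlgebra 𝓘(ℝ, E) G), X⁆ X = 0 := by
  have hderiv := mvfderiv_clm_adjoint_apply_one hι (B.flip X).toContinuousLinearMap A X
  rw [mvfderiv_eq_zero_of_forall_le_one
    ((contMDiff_clm_adjoint_apply hι _ X).mdifferentiable (by simp) 1) fun h => ?_] at hderiv
  · exact hderiv.symm
  · simpa [adjoint_one] using hB.apply_adjoint_le h X

theorem IsAdInvariantInner.lieIncl_lie_skew (hB : IsAdInvariantInner H B)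
    (hι : ContMDiff 𝓘(ℝ, F) 𝓘(ℝ, E) ∞ (Subtype.val : H → G))
    (A : GroupLieAlgebra 𝓘(ℝ, F) H) (X Y : GroupLieAlgebra 𝓘(ℝ, E) G) :
    B ⁅(lieIncl H A : GroupLieAlgebra 𝓘(ℝ, E) G), X⁆ Y
      = -B X ⁅(lieIncl H A : GroupLieAlgebra 𝓘(ℝ, E) G), Y⁆ := by
  have hXY := hB.lieIncl_lie_self hι A (X + Y)
  simp only [lie_add, map_add, LinearMap.add_apply, hB.lieIncl_lie_self hι A X,
    hB.lieIncl_lie_self hι A Y] at hXY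
  rw [hB.symm X]
  linarith

end InfinitesimalInvariance

section LieGenerating

variable {E : Type*} [NormedAddCommGroup E] [NormedSpace ℝ E] [CompleteSpace E]
  {G : Type*} [TopologicalSpace G] [ChartedSpace E G] [Group G] [LieGroup 𝓘(ℝ, E) ∞ G]
  {F : Type*} [NormedAddCommGroup F] [NormedSpace ℝ F]
  {H : Subgroup G} [ChartedSpace F H] {N : ℕ} {A : Fin N → GroupLieAlgebra 𝓘(ℝ, F) H}

theorem IsLieGenerating.lieIncl_lie_eq_zero (hA : IsLieGenerating (E := E) H A)
    {X : GroupLieAlgebra 𝓘(ℝ, E) G}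
    (hX : ∀ k, ⁅(lieIncl H (A k) : GroupLieAlgebra 𝓘(ℝ, E) G), X⁆ = 0)
    (C : GroupLieAlgebra 𝓘(ℝ, F) H) : ⁅(lieIncl H C : GroupLieAlgebra 𝓘(ℝ, E) G), X⁆ = 0 := by
  have hmem : (lieIncl H C : GroupLieAlgebra 𝓘(ℝ, E) G) ∈ LieSubalgebra.lieSpan ℝ
      (GroupLieAlgebra 𝓘(ℝ, E) G) (Set.range fun k => lieIncl H (A k)) := by
    rw [← LieSubalgebra.mem_toSubmodule, hA]
    exact LinearMap.mem_range_self _ C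
  generalize (lieIncl H C : GroupLieAlgebra 𝓘(ℝ, E) G) = Y at hmem ⊢
  induction hmem using LieSubalgebra.lieSpan_induction with
  | mem Y hY => obtain ⟨k, rfl⟩ := hY; exact hX k
  | zero => exact zero_lie X
  | add Y Z _ _ hY hZ => rw [add_lie, hY, hZ, add_zero]
  | smul c Y _ hY => rw [smul_lie, hY, smul_zero]
  | lie Y Z _ _ hY hZ => rw [lie_lie, hY, hZ, lie_zero, lie_zero, sub_zero]

end LieGenerating

section OrthonormalBasis

variable {E : Type*} [NormedAddCommGroup E] [NormedSpace ℝ E]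
  {G : Type*} [TopologicalSpace G] [ChartedSpace E G] [Group G]
  {B : LinearMap.BilinForm ℝ (GroupLieAlgebra 𝓘(ℝ, E) G)}
  {V : Submodule ℝ (GroupLieAlgebra 𝓘(ℝ, E) G)} {d : ℕ}
  {Y Z : Fin d → GroupLieAlgebra 𝓘(ℝ, E) G}

theorem IsOrthonormalBasisOf.mem (hY : IsOrthonormalBasisOf B V Y) (i : Fin d) : Y i ∈ V :=
  hY.span_eq ▸ Submodule.subset_span (Set.mem_range_self i)

theorem IsOrthonormalBasisOf.sum_smul_eq (hY : IsOrthonormalBasisOf B V Y)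
    {X : GroupLieAlgebra 𝓘(ℝ, E) G} (hX : X ∈ V) : ∑ i, B X (Y i) • Y i = X := by
  rw [← hY.span_eq, Submodule.mem_span_range_iff_exists_fun ℝ] at hX
  obtain ⟨c, rfl⟩ := hX
  simp [LinearMap.sum_apply, hY.orthonormal]

theorem IsOrthonormalBasisOf.sum_bilin_eq (hY : IsOrthonormalBasisOf B V Y)
    (hZ : IsOrthonormalBasisOf B V Z) (hB : ∀ X X', B X X' = B X' X)
    (D : LinearMap.BilinForm ℝ (GroupLieAlgebra 𝓘(ℝ, E) G)) :
    ∑ i, D (Y i) (Y i) = ∑ j, D (Z j) (Z j) :=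
  calc ∑ i, D (Y i) (Y i) = ∑ i, ∑ j, B (Y i) (Z j) * D (Y i) (Z j) :=
        Finset.sum_congr rfl fun i _ => by
          simpa using congrArg (D (Y i)) (hZ.sum_smul_eq (hY.mem i)).symm
    _ = ∑ j, ∑ i, B (Z j) (Y i) * D (Y i) (Z j) := by
        rw [Finset.sum_comm]
        simp only [hB (Y _)]
    _ = ∑ j, D (Z j) (Z j) := Finset.sum_congr rfl fun j _ => by
        simpa using congrArg (D.flip (Z j)) (hY.sum_smul_eq (hZ.mem j))

theorem sumSquares_eq [LieGroup 𝓘(ℝ, E) ∞ G] (hY : IsOrthonormalBasisOf B V Y)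
    (hZ : IsOrthonormalBasisOf B V Z) (hB : ∀ X X', B X X' = B X' X) {f : G → ℝ}
    (hf : ContMDiff 𝓘(ℝ, E) 𝓘(ℝ, ℝ) 2 f) : sumSquares Y f = sumSquares Z f := by
  funext g
  have hd : ∀ X : GroupLieAlgebra 𝓘(ℝ, E) G, MDifferentiable 𝓘(ℝ, E) 𝓘(ℝ, ℝ) (leftDeriv X f) :=
    fun X => (contMDiff_leftDeriv (m := 1) hf (by norm_num) (by norm_num) X).mdifferentiable
      (by simp)
  exact hY.sum_bilin_eq hZ hB <| LinearMap.mk₂ ℝ (fun X X' => leftDeriv X (leftDeriv X' f) g)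
    (fun X X' W => by rw [leftDeriv_add_left]; rfl)
    (fun c X W => by rw [leftDeriv_smul_left]; rfl)
    (fun X W W' => by rw [leftDeriv_add_left, leftDeriv_add (hd _) (hd _)]; rfl)
    (fun c X W => by rw [leftDeriv_smul_left, leftDeriv_const_smul (hd _)]; rfl)

end OrthonormalBasis

section MatrixCoefficient

variable {E : Type*} [NormedAddCommGroup E] [NormedSpace ℝ E] [FiniteDimensional ℝ E]
  {G : Type*} [TopologicalSpace G] [ChartedSpace E G] [Group G] [LieGroup 𝓘(ℝ, E) ∞ G]
  {F : Type*} [NormedAddCommGroup F] [NormedSpace ℝ F]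
  {H : Subgroup G} [ChartedSpace F H]

theorem contMDiff_adCoeff (hι : ContMDiff 𝓘(ℝ, F) 𝓘(ℝ, E) ∞ (Subtype.val : H → G))
    (B : LinearMap.BilinForm ℝ (GroupLieAlgebra 𝓘(ℝ, E) G)) (X Y : GroupLieAlgebra 𝓘(ℝ, E) G) :
    ContMDiff 𝓘(ℝ, F) 𝓘(ℝ, ℝ) ∞ (adCoeff (H := H) B X Y) :=
  contMDiff_clm_adjoint_apply hι (B.flip Y).toContinuousLinearMap X

variable [LieGroup 𝓘(ℝ, F) ∞ H]

theorem leftDeriv_adCoeff (hι : ContMDiff 𝓘(ℝ, F) 𝓘(ℝ, E) ∞ (Subtype.val : H → G))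
    (B : LinearMap.BilinForm ℝ (GroupLieAlgebra 𝓘(ℝ, E) G)) (A : GroupLieAlgebra 𝓘(ℝ, F) H)
    (X Y : GroupLieAlgebra 𝓘(ℝ, E) G) :
    leftDeriv A (adCoeff B X Y)
      = adCoeff B ⁅(lieIncl H A : GroupLieAlgebra 𝓘(ℝ, E) G), X⁆ Y :=
  funext fun h => mvfderiv_clm_adjoint_apply hι (B.flip Y).toContinuousLinearMap A X h

/-- The operator `½ ∑ₖ ad²(Aₖ)` on the Lie algebra of `G`, the counterpart of the operator
`½ ∑ₖ (Aₖ)²` on `H`. -/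
def halfSumAdSq {N : ℕ} (A : Fin N → GroupLieAlgebra 𝓘(ℝ, F) H) (X : GroupLieAlgebra 𝓘(ℝ, E) G) :
    GroupLieAlgebra 𝓘(ℝ, E) G :=
  (1 / 2 : ℝ) • ∑ k, ⁅(lieIncl H (A k) : GroupLieAlgebra 𝓘(ℝ, E) G),
    ⁅(lieIncl H (A k) : GroupLieAlgebra 𝓘(ℝ, E) G), X⁆⁆

theorem hormanderOp_adCoeff (hι : ContMDiff 𝓘(ℝ, F) 𝓘(ℝ, E) ∞ (Subtype.val : H → G))
    (B : LinearMap.BilinForm ℝ (GroupLieAlgebra 𝓘(ℝ, E) G)) {N : ℕ}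
    (A : Fin N → GroupLieAlgebra 𝓘(ℝ, F) H) (X Y : GroupLieAlgebra 𝓘(ℝ, E) G) :
    hormanderOp 0 A (adCoeff B X Y) = adCoeff B (halfSumAdSq A X) Y := by
  funext h
  simp [hormanderOp, halfSumAdSq, leftDeriv_adCoeff hι, adCoeff, LinearMap.sum_apply]

end MatrixCoefficient

section AdModule

open scoped InnerProductSpace

variable {E : Type*} [NormedAddCommGroup E] [NormedSpace ℝ E]
  {G : Type*} [TopologicalSpace G] [ChartedSpace E G] [Group G]
  {H : Subgroup G} {B : LinearMap.BilinForm ℝ (GroupLieAlgebra 𝓘(ℝ, E) G)}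
  {W : Submodule ℝ (GroupLieAlgebra 𝓘(ℝ, E) G)}

/-- A subspace `W` of the Lie algebra of `G`, as a Euclidean space for an `Ad_H`-invariant inner
product. It is a type synonym because `W` itself carries the norm inherited from the model space. -/
def AdModule (_hB : IsAdInvariantInner H B) (W : Submodule ℝ (GroupLieAlgebra 𝓘(ℝ, E) G)) :
    Type _ := W

namespace AdModule

variable (hB : IsAdInvariantInner H B)

instance : AddCommGroup (AdModule hB W) := inferInstanceAs (AddCommGroup W)

instance : Module ℝ (AdModule hB W) := inferInstanceAs (Module ℝ W)

instance [FiniteDimensional ℝ E] : FiniteDimensional ℝ (AdModule hB W) :=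
  inferInstanceAs (FiniteDimensional ℝ W)

/-- The inner product `B` on `W`. -/
abbrev innerCore : InnerProductSpace.Core ℝ (AdModule hB W) where
  inner X Y := B X.1 Y.1
  conj_inner_symm X Y := hB.symm _ _
  re_inner_nonneg X := by
    rcases eq_or_ne X.1 0 with h | h
    · simp [h]
    · exact (hB.pos _ h).le
  add_left X Y Z := LinearMap.map_add₂ B X.1 Y.1 Z.1
  smul_left X Y c := LinearMap.map_smul₂ B c X.1 Y.1
  definite X hX := Subtype.ext <| by_contra fun h => (hB.pos _ h).ne' hX

instance : NormedAddCommGroup (AdModule hB W) :=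
  (innerCore hB).toNormedAddCommGroup

instance : InnerProductSpace ℝ (AdModule hB W) :=
  InnerProductSpace.ofCore (innerCore hB).toCore

variable [LieGroup 𝓘(ℝ, E) ∞ G]

/-- The adjoint action of `H` on an `Ad_H`-invariant subspace `W`. -/
def adRep (hW : IsAdInvariant H W) : Representation ℝ H (AdModule hB W) where
  toFun h := (adjoint (h : G)).toLinearMap.restrict fun X hX => hW h h.2 X hX
  map_one' := LinearMap.ext fun X => Subtype.ext (congrArg (· X.1) adjoint_one)
  map_mul' g h := LinearMap.ext fun X => Subtype.ext (adjoint_mul_apply (g : G) h X.1)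

variable {hB} in
theorem inner_adRep_adRep (hW : IsAdInvariant H W) (h : H) (X Y : AdModule hB W) :
    ⟪adRep hB hW h X, adRep hB hW h Y⟫_ℝ = ⟪X, Y⟫_ℝ :=
  hB.invariant h h.2 X.1 Y.1

theorem isIrreducible_adRep (hW : IsAdIrreducible H W) :
    (adRep hB hW.invariant).IsIrreducible where
  exists_pair_ne := by
    refine ⟨⊥, ⊤, fun h => hW.ne_bot ?_⟩
    have hbot : (⊥ : Submodule ℝ W) = ⊤ := congrArg Subrepresentation.toSubmodule h
    rw [← W.map_subtype_top, ← hbot, Submodule.map_bot]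
  eq_bot_or_eq_top U := by
    let U' : Submodule ℝ W := U.toSubmodule
    have hmap : Function.Injective (Submodule.map W.subtype) :=
      Submodule.map_injective_of_injective W.injective_subtype
    have hinv : IsAdInvariant H (U'.map W.subtype) := by
      rintro h hh _ ⟨X, hX, rfl⟩
      exact ⟨_, U.apply_mem_toSubmodule ⟨h, hh⟩ hX, rfl⟩
    refine (hW.eq_bot_or_eq _ (Submodule.map_subtype_le W U') hinv).imp (fun h => ?_) fun h => ?_
    · exact Subrepresentation.toSubmodule_injective <| hmap <| h.trans (Submodule.map_bot _).symm
    · exact Subrepresentation.toSubmodule_injective <| hmap <| h.trans W.map_subtype_top.symm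

variable [FiniteDimensional ℝ E]
  {F : Type*} [NormedAddCommGroup F] [NormedSpace ℝ F] [ChartedSpace F H]

/-- The operator `ad A`, for `A` in the Lie algebra of `H`, on an `Ad_H`-invariant subspace `W`. -/
def adEnd (hι : ContMDiff 𝓘(ℝ, F) 𝓘(ℝ, E) ∞ (Subtype.val : H → G)) (hW : IsAdInvariant H W)
    (A : GroupLieAlgebra 𝓘(ℝ, F) H) : Module.End ℝ (AdModule hB W) :=
  (LieAlgebra.ad ℝ (GroupLieAlgebra 𝓘(ℝ, E) G) (lieIncl H A)).restrict
    fun _ hX => lieIncl_lie_mem hι hW A hX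

variable {hB} {hι : ContMDiff 𝓘(ℝ, F) 𝓘(ℝ, E) ∞ (Subtype.val : H → G)}

theorem adEnd_ne_zero (hW : IsAdInvariant H W) {A : GroupLieAlgebra 𝓘(ℝ, F) H}
    {X : GroupLieAlgebra 𝓘(ℝ, E) G} (hX : X ∈ W)
    (hne : ⁅(lieIncl H A : GroupLieAlgebra 𝓘(ℝ, E) G), X⁆ ≠ 0) : adEnd hB hι hW A ≠ 0 :=
  fun h => hne (congrArg Subtype.val (LinearMap.congr_fun h ⟨X, hX⟩))

theorem inner_adEnd_left (hW : IsAdInvariant H W) (A : GroupLieAlgebra 𝓘(ℝ, F) H)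
    (X Y : AdModule hB W) :
    ⟪adEnd hB hι hW A X, Y⟫_ℝ = -⟪X, adEnd hB hι hW A Y⟫_ℝ :=
  hB.lieIncl_lie_skew hι A X.1 Y.1

theorem commute_adRep_adEnd [IsMulCommutative H] (hW : IsAdInvariant H W)
    (A : GroupLieAlgebra 𝓘(ℝ, F) H) (h : H) : Commute (adRep hB hW h) (adEnd hB hι hW A) :=
  LinearMap.ext fun X => Subtype.ext <| adjoint_lie_of_comm hι
    (fun k hk => congrArg Subtype.val (mul_comm' h ⟨k, hk⟩)) A X.1

end AdModule
end AdModule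

section IrreducibleSubspace

open MeasureTheory

variable {E : Type*} [NormedAddCommGroup E] [NormedSpace ℝ E] [FiniteDimensional ℝ E]
  {G : Type*} [TopologicalSpace G] [ChartedSpace E G] [Group G] [LieGroup 𝓘(ℝ, E) ∞ G]
  {F : Type*} [NormedAddCommGroup F] [NormedSpace ℝ F]
  {H : Subgroup G} [ChartedSpace F H]
  {B : LinearMap.BilinForm ℝ (GroupLieAlgebra 𝓘(ℝ, E) G)}
  {W : Submodule ℝ (GroupLieAlgebra 𝓘(ℝ, E) G)}

theorem continuous_adRep_apply (hB : IsAdInvariantInner H B) (hW : IsAdInvariant H W)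
    (hι : ContMDiff 𝓘(ℝ, F) 𝓘(ℝ, E) ∞ (Subtype.val : H → G)) (X : AdModule hB W) :
    Continuous fun h : H => AdModule.adRep hB hW h X := by
  have hAd : Continuous fun h : H => (adjoint (h : G) X.1 : GroupLieAlgebra 𝓘(ℝ, E) G) :=
    (contMDiff_clm_adjoint_apply hι (.id ℝ E) X.1).continuous
  let e : W →ₗ[ℝ] AdModule hB W := LinearMap.id
  exact e.continuous_of_finiteDimensional.comp (hAd.subtype_mk fun h => hW h h.2 X.1 X.2)

theorem IsAdIrreducible.integral_adCoeff_mul_adCoeff (hW : IsAdIrreducible H W)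
    (hB : IsAdInvariantInner H B) (hι : ContMDiff 𝓘(ℝ, F) 𝓘(ℝ, E) ∞ (Subtype.val : H → G))
    [MeasurableSpace G] [BorelSpace G] {μ : Measure H} [IsProbabilityMeasure μ]
    [μ.IsMulLeftInvariant] {X Y Z : GroupLieAlgebra 𝓘(ℝ, E) G} (hX : X ∈ W) (hY : Y ∈ W)
    (hZ : Z ∈ W) :
    ∫ h, adCoeff B X Y h * adCoeff B X Z h ∂μ = B X X / Module.finrank ℝ W * B Y Z := by
  have : IsTopologicalGroup G := topologicalGroup_of_lieGroup 𝓘(ℝ, E) ∞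
  have := AdModule.isIrreducible_adRep hB hW
  let x : AdModule hB W := ⟨X, hX⟩
  have : ProperSpace (AdModule hB W) := .of_locallyCompactSpace ℝ
  have hnorm : ‖x‖ ^ 2 = B X X := (real_inner_self_eq_norm_sq x).symm
  rw [← hnorm]
  exact integral_inner_mul_inner (AdModule.inner_adRep_adRep hW.invariant)
    (continuous_adRep_apply hB hW.invariant hι x).aestronglyMeasurable ⟨Y, hY⟩ ⟨Z, hZ⟩

variable [IsMulCommutative H]

theorem IsAdIrreducible.finrank_eq_two (hW : IsAdIrreducible H W)
    (hB : IsAdInvariantInner H B) (hι : ContMDiff 𝓘(ℝ, F) 𝓘(ℝ, E) ∞ (Subtype.val : H → G))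
    {A : GroupLieAlgebra 𝓘(ℝ, F) H} {X : GroupLieAlgebra 𝓘(ℝ, E) G} (hX : X ∈ W)
    (hne : ⁅(lieIncl H A : GroupLieAlgebra 𝓘(ℝ, E) G), X⁆ ≠ 0) : Module.finrank ℝ W = 2 :=
  have := AdModule.isIrreducible_adRep hB hW
  finrank_eq_two_of_commute_skew (AdModule.inner_adRep_adRep (hB := hB) hW.invariant)
    (AdModule.inner_adEnd_left (hι := hι) hW.invariant A)
    (AdModule.commute_adRep_adEnd hW.invariant A)
    (AdModule.adEnd_ne_zero (hι := hι) hW.invariant hX hne)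

theorem IsAdIrreducible.exists_halfSumAdSq_eq_neg_smul (hW : IsAdIrreducible H W)
    (hB : IsAdInvariantInner H B) (hι : ContMDiff 𝓘(ℝ, F) 𝓘(ℝ, E) ∞ (Subtype.val : H → G))
    {N : ℕ} {A : Fin N → GroupLieAlgebra 𝓘(ℝ, F) H} {k : Fin N} {X : GroupLieAlgebra 𝓘(ℝ, E) G}
    (hX : X ∈ W) (hne : ⁅(lieIncl H (A k) : GroupLieAlgebra 𝓘(ℝ, E) G), X⁆ ≠ 0) :
    ∃ lam : ℝ, 0 < lam ∧ ∀ Y ∈ W, halfSumAdSq A Y = -(lam • Y) := by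
  have := AdModule.isIrreducible_adRep hB hW
  obtain ⟨c, hc, hsum⟩ := exists_sum_sq_eq_neg_smul_of_commute_skew (AdModule.adRep hB hW.invariant)
    (fun k => AdModule.inner_adEnd_left (hι := hι) hW.invariant (A k))
    (fun k => AdModule.commute_adRep_adEnd hW.invariant (A k))
    ⟨k, AdModule.adEnd_ne_zero hW.invariant hX hne⟩
  refine ⟨c / 2, by positivity, fun Y hY => ?_⟩
  have hsumY : ∑ k, ⁅(lieIncl H (A k) : GroupLieAlgebra 𝓘(ℝ, E) G),
      ⁅(lieIncl H (A k) : GroupLieAlgebra 𝓘(ℝ, E) G), Y⁆⁆ = -(c • Y) := by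
    let incl : AdModule hB W →ₗ[ℝ] GroupLieAlgebra 𝓘(ℝ, E) G := W.subtype
    exact (map_sum incl _ _).symm.trans (congrArg incl (hsum ⟨Y, hY⟩))
  rw [halfSumAdSq, hsumY]
  module

end IrreducibleSubspace

section Torus

variable {G : Type*} [TopologicalSpace G] [Group G] {K : Subgroup G}

theorem IsTorus.compactSpace (hK : IsTorus K) : CompactSpace K :=
  isCompact_iff_compactSpace.1 hK.compact

theorem IsTorus.preconnectedSpace (hK : IsTorus K) : PreconnectedSpace K :=
  isPreconnected_iff_preconnectedSpace.1 hK.connected.isPreconnected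

theorem IsTorus.isMulCommutative (hK : IsTorus K) : IsMulCommutative K :=
  .of_comm fun x y => Subtype.ext (hK.comm x x.2 y y.2)

end Torus

theorem isMulRightInvariant_of_isMulCommutative {Γ : Type*} [Group Γ] [IsMulCommutative Γ]
    [MeasurableSpace Γ] (μ : MeasureTheory.Measure Γ) [μ.IsMulLeftInvariant] :
    μ.IsMulRightInvariant where
  map_mul_right_eq_self g := by
    simpa only [mul_comm' _ g] using MeasureTheory.map_mul_left_eq_self μ g

section PoissonEquation

open MeasureTheory

variable {E : Type*} [NormedAddCommGroup E] [NormedSpace ℝ E]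
  {G : Type*} [TopologicalSpace G] [ChartedSpace E G] [Group G] [LieGroup 𝓘(ℝ, E) ∞ G]
  {F : Type*} [NormedAddCommGroup F] [NormedSpace ℝ F]
  {H : Subgroup G} [ChartedSpace F H] [LieGroup 𝓘(ℝ, F) ∞ H]
  {B : LinearMap.BilinForm ℝ (GroupLieAlgebra 𝓘(ℝ, E) G)}
  {N : ℕ} {A : Fin N → GroupLieAlgebra 𝓘(ℝ, F) H}

theorem IsAdDecomposition.exists_lie_ne_zero [CompleteSpace E] [PreconnectedSpace H] {r : ℕ}
    {𝔪 : Fin (r + 1) → Submodule ℝ (GroupLieAlgebra 𝓘(ℝ, E) G)}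
    (h𝔪 : IsAdDecomposition (F := F) H B 𝔪) (hB : IsAdInvariantInner H B)
    (hι : ContMDiff 𝓘(ℝ, F) 𝓘(ℝ, E) ∞ (Subtype.val : H → G))
    (hA : IsLieGenerating (E := E) H A) {l : Fin (r + 1)} (hl : l ≠ 0)
    {X : GroupLieAlgebra 𝓘(ℝ, E) G} (hX : X ∈ 𝔪 l) (hX₀ : X ≠ 0) :
    ∃ k, ⁅(lieIncl H (A k) : GroupLieAlgebra 𝓘(ℝ, E) G), X⁆ ≠ 0 := by
  by_contra! h
  have hfixed := adjoint_eq_self_of_forall_lie_eq_zero hι (hA.lieIncl_lie_eq_zero h)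
  have hX𝔪 : X ∈ B.orthogonal (lieSubspace (F := F) H) := h𝔪.iSup_eq ▸ le_iSup 𝔪 l hX
  have hX𝔪₀ : X ∈ 𝔪 0 := (h𝔪.mem_zero X).2 ⟨hX𝔪, fun h hh => hfixed ⟨h, hh⟩⟩
  exact (hB.pos X hX₀).ne' (h𝔪.orthogonal l 0 hl X hX X hX𝔪₀)

variable [FiniteDimensional ℝ E] {lam : ℝ} {X : GroupLieAlgebra 𝓘(ℝ, E) G}

theorem hormanderOp_adCoeff_of_halfSumAdSq_eq
    (hι : ContMDiff 𝓘(ℝ, F) 𝓘(ℝ, E) ∞ (Subtype.val : H → G))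
    (hX : halfSumAdSq A X = -(lam • X))
    (Y : GroupLieAlgebra 𝓘(ℝ, E) G) (h : H) :
    hormanderOp 0 A (adCoeff B X Y) h = -lam * adCoeff B X Y h := by
  simp [hormanderOp_adCoeff hι, hX, adCoeff]

theorem isPoissonSolution_adCoeff (hι : ContMDiff 𝓘(ℝ, F) 𝓘(ℝ, E) ∞ (Subtype.val : H → G))
    (hlam : lam ≠ 0) (hX : halfSumAdSq A X = -(lam • X)) (Y : GroupLieAlgebra 𝓘(ℝ, E) G) :
    IsPoissonSolution 0 A (adCoeff (H := H) B X Y) (adCoeff B X (-lam⁻¹ • Y)) where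
  contMDiff := (contMDiff_adCoeff hι B _ _).of_le ENat.LEInfty.out
  eq h := by
    rw [hormanderOp_adCoeff_of_halfSumAdSq_eq hι hX]
    simp [adCoeff, hlam]

variable [CompleteSpace F] [CompactSpace H] [MeasurableSpace G] [BorelSpace G] {μ : Measure H}
  [μ.IsMulRightInvariant]

theorem integral_adCoeff_mul_of_isPoissonSolution [IsFiniteMeasure μ]
    (hι : ContMDiff 𝓘(ℝ, F) 𝓘(ℝ, E) ∞ (Subtype.val : H → G)) (hlam : lam ≠ 0)
    (hX : halfSumAdSq A X = -(lam • X)) (Y : GroupLieAlgebra 𝓘(ℝ, E) G) {α β : H → ℝ}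
    (hβ : IsPoissonSolution 0 A α β) :
    ∫ h, adCoeff B X Y h * β h ∂μ = -(lam⁻¹ * ∫ h, adCoeff B X Y h * α h ∂μ) := by
  have hcomm := integral_hormanderOp_mul_comm (μ := μ)
    ((contMDiff_adCoeff hι B X Y).of_le ENat.LEInfty.out) hβ.contMDiff A
  simp only [hormanderOp_adCoeff_of_halfSumAdSq_eq hι hX, hβ.eq, mul_assoc,
    integral_const_mul] at hcomm
  rw [← hcomm]
  field_simp

variable {W : Submodule ℝ (GroupLieAlgebra 𝓘(ℝ, E) G)} {d : ℕ}
  {Y₀ : GroupLieAlgebra 𝓘(ℝ, E) G} {Y Z : Fin d → GroupLieAlgebra 𝓘(ℝ, E) G}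

theorem IsAdIrreducible.effectiveOp_eq [IsProbabilityMeasure μ] [μ.IsMulLeftInvariant]
    (hW : IsAdIrreducible H W) (hB : IsAdInvariantInner H B)
    (hι : ContMDiff 𝓘(ℝ, F) 𝓘(ℝ, E) ∞ (Subtype.val : H → G)) (hlam : lam ≠ 0)
    (hY₀ : Y₀ ∈ W)
    (heig : halfSumAdSq A Y₀ = -(lam • Y₀))
    (hY : IsOrthonormalBasisOf B W Y) (hZ : IsOrthonormalBasisOf B W Z) {β : Fin d → H → ℝ}
    (hβ : ∀ j, IsPoissonSolution 0 A (adCoeff B Y₀ (Y j)) (β j)) {f : G → ℝ}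
    (hf : ContMDiff 𝓘(ℝ, E) 𝓘(ℝ, ℝ) 2 f) (g : G) :
    effectiveOp μ B Y₀ Y β f g
      = B Y₀ Y₀ / (Module.finrank ℝ W * lam) * sumSquares Z f g := by
  have hint : ∀ i j, ∫ h, adCoeff B Y₀ (Y i) h * β j h ∂μ
      = if i = j then -(B Y₀ Y₀ / (Module.finrank ℝ W * lam)) else 0 := fun i j => by
    rw [integral_adCoeff_mul_of_isPoissonSolution hι hlam heig (Y i) (hβ j),
      hW.integral_adCoeff_mul_adCoeff hB hι hY₀ (hY.mem i) (hY.mem j), hY.orthonormal]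
    split_ifs <;> field_simp; simp
  rw [sumSquares_eq hZ hY hB.symm hf]
  simp [effectiveOp, hint, sumSquares, Finset.mul_sum]

end PoissonEquation

end

end EffectiveLimit

theorem mainTheorem8_general
    {E : Type*} [NormedAddCommGroup E] [NormedSpace ℝ E] [FiniteDimensional ℝ E]
    {G : Type*} [TopologicalSpace G] [ChartedSpace E G]
    [Group G] [LieGroup 𝓘(ℝ, E) ∞ G] [MeasurableSpace G] [BorelSpace G]
    {F : Type*} [NormedAddCommGroup F] [NormedSpace ℝ F] [FiniteDimensional ℝ F]
    (H : Subgroup G) [ChartedSpace F H] [LieGroup 𝓘(ℝ, F) ∞ H]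
    (hHG : IsEmbeddedSubgroup (E := E) (F := F) H) (hH : IsTorus H)
    (μ : MeasureTheory.Measure H) [μ.IsHaarMeasure] [MeasureTheory.IsProbabilityMeasure μ]
    (B : LinearMap.BilinForm ℝ (GroupLieAlgebra 𝓘(ℝ, E) G)) (hB : IsAdInvariantInner H B)
    {r : ℕ} (𝔪 : Fin (r + 1) → Submodule ℝ (GroupLieAlgebra 𝓘(ℝ, E) G))
    (h𝔪 : IsAdDecomposition (F := F) H B 𝔪)
    {N : ℕ} (A : Fin N → GroupLieAlgebra 𝓘(ℝ, F) H) (hA : IsLieGenerating (E := E) H A)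
    (l : Fin (r + 1)) (hl : l ≠ 0) :
    ∃ lam : ℝ, 0 < lam ∧
      (∀ c : ℝ,
        (∀ X ∈ 𝔪 l, (1 / 2 : ℝ) • ∑ k, ⁅(lieIncl H (A k) : GroupLieAlgebra 𝓘(ℝ, E) G),
          ⁅(lieIncl H (A k) : GroupLieAlgebra 𝓘(ℝ, E) G), X⁆⁆ = -(c • X)) ↔ c = lam) ∧
      ∀ Y₀ ∈ 𝔪 l, ∀ {d : ℕ} (Y : Fin d → GroupLieAlgebra 𝓘(ℝ, E) G),
        IsOrthonormalBasisOf B (𝔪 l) Y →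
        (∀ j, ∃ β : H → ℝ, ContMDiff 𝓘(ℝ, F) 𝓘(ℝ, ℝ) ∞ β ∧
          IsPoissonSolution 0 A (adCoeff B Y₀ (Y j)) β) ∧
        ∀ β : Fin d → H → ℝ,
          (∀ j, IsPoissonSolution 0 A (adCoeff B Y₀ (Y j)) (β j)) →
          ∀ Z : Fin d → GroupLieAlgebra 𝓘(ℝ, E) G, IsOrthonormalBasisOf B (𝔪 l) Z →
          ∀ f : G → ℝ, ContMDiff 𝓘(ℝ, E) 𝓘(ℝ, ℝ) 2 f →
          ∀ g : G, effectiveOp μ B Y₀ Y β f g = B Y₀ Y₀ / (2 * lam) * sumSquares Z f g := by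
  have hι := hHG.smooth
  have := hH.compactSpace
  have := hH.preconnectedSpace
  have := hH.isMulCommutative
  have := FiniteDimensional.complete ℝ F
  have : μ.IsMulRightInvariant := isMulRightInvariant_of_isMulCommutative μ
  have hW := h𝔪.irreducible l hl
  obtain ⟨X, hX, hX₀⟩ := Submodule.exists_mem_ne_zero_of_ne_bot hW.ne_bot
  obtain ⟨k, hk⟩ := h𝔪.exists_lie_ne_zero hB hι hA hl hX hX₀
  obtain ⟨lam, hlam, heig⟩ := hW.exists_halfSumAdSq_eq_neg_smul hB hι hX hk
  refine ⟨lam, hlam, fun c => ⟨fun hc => ?_, fun hc => hc ▸ heig⟩,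
    fun Y₀ hY₀ d Y hY => ⟨fun j => ?_, fun β hβ Z hZ f hf g => ?_⟩⟩
  · exact smul_left_injective ℝ hX₀ (neg_injective ((hc X hX).symm.trans (heig X hX)))
  · exact ⟨_, contMDiff_adCoeff hι B _ _, isPoissonSolution_adCoeff hι hlam.ne' (heig Y₀ hY₀) (Y j)⟩
  · simpa [hW.finrank_eq_two hB hι hX hk] using
      hW.effectiveOp_eq (μ := μ) hB hι hlam.ne' hY₀ (heig Y₀ hY₀) hY hZ hβ hf g

theorem mainTheorem8
    {E : Type*} [NormedAddCommGroup E] [NormedSpace ℝ E] [FiniteDimensional ℝ E] [CompleteSpace E]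
    {G : Type*} [TopologicalSpace G] [T2Space G] [ConnectedSpace G] [ChartedSpace E G]
    [Group G] [LieGroup 𝓘(ℝ, E) ∞ G] [MeasurableSpace G] [BorelSpace G]
    (hG : LieAlgebra.IsSemisimple ℝ (GroupLieAlgebra 𝓘(ℝ, E) G))
    {F : Type*} [NormedAddCommGroup F] [NormedSpace ℝ F] [FiniteDimensional ℝ F]
    (H : Subgroup G) [ChartedSpace F H] [LieGroup 𝓘(ℝ, F) ∞ H]
    (hHG : IsEmbeddedSubgroup (E := E) (F := F) H) (hH : IsMaximalTorus H)
    (μ : MeasureTheory.Measure H) [μ.IsHaarMeasure] [MeasureTheory.IsProbabilityMeasure μ]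
    (B : LinearMap.BilinForm ℝ (GroupLieAlgebra 𝓘(ℝ, E) G)) (hB : IsAdInvariantInner H B)
    {r : ℕ} (𝔪 : Fin (r + 1) → Submodule ℝ (GroupLieAlgebra 𝓘(ℝ, E) G))
    (h𝔪 : IsAdDecomposition (F := F) H B 𝔪)
    {N : ℕ} (A : Fin N → GroupLieAlgebra 𝓘(ℝ, F) H) (hA : IsLieGenerating (E := E) H A)
    (l : Fin (r + 1)) (hl : l ≠ 0) :
    ∃ lam : ℝ, 0 < lam ∧
      (∀ c : ℝ,
        (∀ X ∈ 𝔪 l, (1 / 2 : ℝ) • ∑ k, ⁅(lieIncl H (A k) : GroupLieAlgebra 𝓘(ℝ, E) G),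
          ⁅(lieIncl H (A k) : GroupLieAlgebra 𝓘(ℝ, E) G), X⁆⁆ = -(c • X)) ↔ c = lam) ∧
      ∀ Y₀ ∈ 𝔪 l, ∀ {d : ℕ} (Y : Fin d → GroupLieAlgebra 𝓘(ℝ, E) G),
        IsOrthonormalBasisOf B (𝔪 l) Y →
        (∀ j, ∃ β : H → ℝ, ContMDiff 𝓘(ℝ, F) 𝓘(ℝ, ℝ) ∞ β ∧
          IsPoissonSolution 0 A (adCoeff B Y₀ (Y j)) β) ∧
        ∀ β : Fin d → H → ℝ,
          (∀ j, IsPoissonSolution 0 A (adCoeff B Y₀ (Y j)) (β j)) →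
          ∀ Z : Fin d → GroupLieAlgebra 𝓘(ℝ, E) G, IsOrthonormalBasisOf B (𝔪 l) Z →
          ∀ f : G → ℝ, ContMDiff 𝓘(ℝ, E) 𝓘(ℝ, ℝ) 2 f →
          ∀ g : G, effectiveOp μ B Y₀ Y β f g = B Y₀ Y₀ / (2 * lam) * sumSquares Z f g :=
  mainTheorem8_general H hHG hH.toIsTorus μ B hB 𝔪 h𝔪 A hA l hl
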